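/- For an integer $n\ge 0$ and a weight $w\ge 0$ on $\mathbb{R}$, let $\mathrm{OE}_n(w)$ (take $\beta=1$) and $\mathrm{UE}_n(w)$ (take $\beta=2$) denote the random $n$-point ensembles of eigenvalues with joint probability density $$c_{n,\beta}\prod_{k=1}^n w(x_k)\prod_{1\le j<k\le n}|x_k-x_j|^\beta$$ on $\mathbb{R}^n$, where $c_{n,\beta}$ is the normalization constant. Let $|\mathrm{OE}_n(w)|$ and $|\mathrm{UE}_n(w)|$ be the corresponding ensembles of singular values, i.e. of the absolute values of the eigenvalues, and let $\mathrm{even}\,|\mathrm{OE}_n(w)|$ be the ensemble of the $\lfloor n/2\rfloor$ points that consists of the 2nd largest, 4th largest, 6th largest, ... singular value. Let $(w_1,w_2)$ be one of the following pairs of even weights: - (Gauss) $w_1(x)=e^{-x^2/2}$, $w_2(x)=e^{-x^2}$ on $\mathbb{R}$; - (symmetric Jacobi) $w_1(x)=(1-x^2)^a$, $w_2(x)=(1-x^2)^{2a+1}$ on $(-1,1)$ and $0$ elsewhere, with a real $a>-1$; - (Cauchy) $w_1(x)=(1+x^2)^{-(n+a+1)/2}$, $w_2(x)=(1+x^2)^{-(n+a)}$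 on $\mathbb{R}$, with a real $a>0$. Then the densities of $\mathrm{UE}_n(w_2)$, $\mathrm{OE}_n(w_1)$ and $\mathrm{OE}_{n+1}(w_1)$ can be normalized, so that these ensembles exist, and $$|\mathrm{UE}_n(w_2)|\ \overset{\mathrm d}{=}\ \mathrm{even}\,|\mathrm{OE}_n(w_1)|\ \cup\ \mathrm{even}\,|\mathrm{OE}_{n+1}(w_1)|,$$ where the two ensembles on the right are drawn independently, $\cup$ is the superposition (union of the points, with multiplicities), and $\overset{\mathrm d}{=}$ is equality of the joint distributions, i.e. of the laws of the decreasingly ordered $n$-tuples of points. (In the Cauchy case the same function $w_1$, with the same $n$ in its exponent, is used for $\mathrm{OE}_n$ and for $\mathrm{OE}_{n+1}$.) -/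

import Mathlib

open MeasureTheory ProbabilityTheory

noncomputable section

namespace RandomEnsemble

/-- The Gauss weight of parameter `c`, namely `exp (-c x²)` on the whole line. -/
def gaussWeight (c : ℝ) (x : ℝ) : ℝ := Real.exp (-(c * x ^ 2))

/-- The symmetric Jacobi weight `(1 - x²)^b`, supported on `(-1, 1)`. -/
def jacobiWeight (b : ℝ) : ℝ → ℝ :=
  Set.indicator (Set.Ioo (-1) 1) fun x => (1 - x ^ 2) ^ b

/-- The Cauchy weight `(1 + x²)^(-b)` on the whole line. -/
def cauchyWeight (b : ℝ) (x : ℝ) : ℝ := (1 + x ^ 2) ^ (-b)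

/-- The pairs `(w₁, w₂)` of even weights attached to the order `n`. In the Cauchy case the weights
depend on `n`, and `0 < a` says exactly that the orthogonal ensemble of order `n + 1` with the
weight `w₁` exists, i.e. that its density can be normalized. -/
inductive IsWeightPair (n : ℕ) : (ℝ → ℝ) → (ℝ → ℝ) → Prop
  | gauss : IsWeightPair n (gaussWeight (1 / 2)) (gaussWeight 1)
  | jacobi (a : ℝ) (ha : -1 < a) : IsWeightPair n (jacobiWeight a) (jacobiWeight (2 * a + 1))
  | cauchy (a : ℝ) (ha : 0 < a) :
      IsWeightPair n (cauchyWeight (((n : ℝ) + a + 1) / 2)) (cauchyWeight ((n : ℝ) + a))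

/-- The unnormalized eigenvalue density `∏ w(x_k) · |Δ(x_1, …, x_n)|^β`, with `Δ` the Vandermonde
determinant. -/
def eigenvalueDensity (β : ℕ) (w : ℝ → ℝ) {n : ℕ} (x : Fin n → ℝ) : ℝ :=
  (∏ k, w (x k)) * |(Matrix.vandermonde x).det| ^ β

/-- The measure on `ℝⁿ` with that density with respect to Lebesgue measure, before
normalization. -/
def weightedMeasure (β : ℕ) (w : ℝ → ℝ) (n : ℕ) : Measure (Fin n → ℝ) :=
  volume.withDensity fun x => ENNReal.ofReal (eigenvalueDensity β w x)

/-- The joint law of the (exchangeably labelled) eigenvalues of the ensemble of order `n` with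
weight `w`. -/
def eigenvalueLaw (β : ℕ) (w : ℝ → ℝ) (n : ℕ) : Measure (Fin n → ℝ) :=
  (weightedMeasure β w n Set.univ)⁻¹ • weightedMeasure β w n

/-- The eigenvalue law of the orthogonal ensemble `OE_n(w)`. -/
def OE (n : ℕ) (w : ℝ → ℝ) : Measure (Fin n → ℝ) := eigenvalueLaw 1 w n

/-- The eigenvalue law of the unitary ensemble `UE_n(w)`. -/
def UE (n : ℕ) (w : ℝ → ℝ) : Measure (Fin n → ℝ) := eigenvalueLaw 2 w n

/-- The entries of `x` listed in decreasing order, with multiplicities. -/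
def decreasing {n : ℕ} (x : Fin n → ℝ) : Fin n → ℝ := fun i => x (Tuple.sort x i.rev)

/-- The singular values, in decreasing order, of a Hermitian matrix with eigenvalues `x`. -/
def singularValues {n : ℕ} (x : Fin n → ℝ) : Fin n → ℝ := decreasing fun i => |x i|

/-- Even-location decimation: of a decreasing sequence keep the 2nd, 4th, 6th, … largest term
(these have the indices 1, 3, 5, … when counting from 0). -/
def even {n : ℕ} (s : Fin n → ℝ) : Fin (n / 2) → ℝ := fun j => s ⟨2 * (j : ℕ) + 1, by omega⟩

/-- Superposition: the union, as a multiset, of two finite sequences, listed in decreasing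
order. -/
def superpose {k l n : ℕ} (h : k + l = n) (s : Fin k → ℝ) (t : Fin l → ℝ) : Fin n → ℝ :=
  fun i => decreasing (Fin.append s t) (Fin.cast h.symm i)

theorem half_add_half (n : ℕ) : n / 2 + (n + 1) / 2 = n := by omega

end RandomEnsemble

end

/-!
All singular values are listed here in increasing order `0 < x₀ < x₁ < ⋯`, and everything is
governed by the checkerboard matrix `M(x)`, whose entry `(i, j)` is `x_i ^ j` if `i + j` is even
and `0` otherwise. Sorting the indices by parity makes it block diagonal, so that `det M(x)` is the
product of a determinant of even powers of the `x_{2j}` and one of odd powers of the `x_{2j+1}`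
(`det_checkerboard`).

*Unitary side.* Expanding over pairs of permutations, the sum over signs `ε` kills every pair which
does not agree modulo 2, and `∑_ε Δ(ε x)²` becomes a multiple of the symmetrization of
`det M(x)²` (`sum_sq_det_vandermonde_signFlip`). So the singular values of the unitary ensemble are
the superposition of two independent ensembles on `(0, ∞)` with densities
`∏ w₂(s_j) · det(s_j ^ (2k + c))²`, `c = 0, 1`, of `⌈n/2⌉` and `⌊n/2⌋` points
(`exists_lintegral_unitary`).

*Orthogonal side.* On the chamber `0 < x₀ < ⋯ < x_{N-1}` the sign of `Δ(ε x)` is `∏ ε_i ^ i`, and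
linearity in the rows gives `∑_ε |Δ(ε x)| = 2 ^ N det M(x)` (`sum_abs_det_vandermonde_signFlip`).
The 2nd, 4th, … largest singular values are one parity class `s` of the `x_i`, the other class `t`
interlaces with it. Integrating out `t` turns the `t`-block of `det M(x)` into a determinant of tail
moments `∫_u^∞ w₁(t) t ^ k dt` at the points of `s`, and at `u = 0` in addition if `N` is odd
(`setLIntegral_pi_cell`). The three weights satisfy a Pearson equation: with `q(x) = 1 + d x²` and
`W = w₁ q` one has `W' = c x w₁`, so that the tail moments of order `k + 2` and `k` differ, up to
constant factors, by `W(u) u ^ (k + 1)`. Column operations turn the determinant into a constant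
times `∏ W(s_j) · det(s_j ^ (2k + r))`, `r ≡ N` modulo 2 (`exists_abs_det_tailMoment`), which is
the `s`-block again. As `w₁ W = w₂`, the law of the even singular values is one of the two ensembles
found on the unitary side: that with `c ≡ N` modulo 2 (`IsPearsonPair.exists_lintegral_orthogonal`).

The two orders `n` and `n + 1` have different parities and hence yield both ensembles. Since all laws
are probability measures, no constant has to be computed (`eq_of_lintegral_eq_const_mul`).
-/

/-! ### The checkerboard matrix and sums over sign changes -/

namespace RandomEnsemble
open Matrix Finset

/-- The checkerboard matrix of `x`: the Vandermonde matrix with all entries of odd `i + j`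
replaced by `0`. -/
def checkerboard {n : ℕ} (x : Fin n → ℝ) : Matrix (Fin n) (Fin n) ℝ :=
  Matrix.of fun i j => if Even ((i : ℕ) + j) then x i ^ (j : ℕ) else 0

/-- The tuple `x` with the sign of each entry multiplied by the sign `ε i`. -/
def signFlip {n : ℕ} (ε : Fin n → ℤˣ) (x : Fin n → ℝ) : Fin n → ℝ := fun i => ((ε i : ℤ) : ℝ) * x i

theorem sum_intUnits_pow (k : ℕ) :
    ∑ e : ℤˣ, ((e : ℤ) : ℝ) ^ k = if Even k then 2 else 0 := by
  rw [UnitsInt.univ, Finset.sum_pair (by decide)]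
  split_ifs with h
  · simp [h.neg_one_pow]; norm_num
  · simp [(Nat.not_even_iff_odd.1 h).neg_one_pow]

/-- On the chamber, the sign of a factor `ε_j x_j - ε_i x_i` with `i < j` is `ε_j`, as `x_j`
dominates `x_i`. -/
theorem abs_det_vandermonde_signFlip {n : ℕ} (ε : Fin n → ℤˣ) {x : Fin n → ℝ} (hx : ∀ i, 0 < x i)
    (hmono : StrictMono x) :
    |(vandermonde (signFlip ε x)).det|
      = (∏ i, ((ε i : ℤ) : ℝ) ^ (i : ℕ)) * (vandermonde (signFlip ε x)).det := by
  have hfac : ∀ i j : Fin n, i < j → |signFlip ε x j - signFlip ε x i|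
      = ((ε j : ℤ) : ℝ) * (signFlip ε x j - signFlip ε x i) := by
    intro i j hij
    have h1 := hx i
    have h2 := hmono hij
    rcases Int.units_eq_one_or (ε i) with hi | hi <;> rcases Int.units_eq_one_or (ε j) with hj | hj
      <;> simp only [signFlip, hi, hj] <;> push_cast
    · rw [abs_of_nonneg (by linarith)]; ring
    · rw [abs_of_nonpos (by linarith)]; ring
    · rw [abs_of_nonneg (by linarith)]; ring
    · rw [abs_of_nonpos (by linarith)]; ring
  rw [det_vandermonde, Finset.abs_prod]
  simp_rw [Finset.abs_prod]
  rw [Finset.prod_congr rfl fun i _ => Finset.prod_congr rfl fun j hj =>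
    hfac i j (Finset.mem_Ioi.1 hj)]
  simp_rw [Finset.prod_mul_distrib]
  congr 1
  -- each sign `ε j` occurs once for every `i < j`
  rw [Finset.prod_comm' (t' := univ) (s' := fun j => Finset.Iio j) (by simp)]
  simp

/-- By linearity in the rows, the sum over all signs can be carried out in each row separately; it
cancels the entries of odd `i + j`. -/
theorem sum_abs_det_vandermonde_signFlip {n : ℕ} {x : Fin n → ℝ} (hx : ∀ i, 0 < x i)
    (hmono : StrictMono x) :
    ∑ ε : Fin n → ℤˣ, |(vandermonde (signFlip ε x)).det| = 2 ^ n * (checkerboard x).det := by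
  have h : ∀ ε : Fin n → ℤˣ, |(vandermonde (signFlip ε x)).det|
      = detRowAlternating.toMultilinearMap fun i : Fin n =>
          (fun j : Fin n => ((ε i : ℤ) : ℝ) ^ ((i : ℕ) + j) * x i ^ (j : ℕ)) := by
    intro ε
    rw [abs_det_vandermonde_signFlip ε hx hmono, ← det_mul_column]
    refine congrArg Matrix.det ?_
    ext i j
    simp [signFlip, vandermonde_apply, mul_pow, pow_add, mul_assoc]
  simp_rw [h]
  rw [← MultilinearMap.map_sum detRowAlternating.toMultilinearMap
    (fun (i : Fin n) (e : ℤˣ) =>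
      (fun j : Fin n => ((e : ℤ) : ℝ) ^ ((i : ℕ) + j) * x i ^ (j : ℕ)))]
  have h2 : (fun i : Fin n => ∑ e : ℤˣ,
      (fun j : Fin n => ((e : ℤ) : ℝ) ^ ((i : ℕ) + j) * x i ^ (j : ℕ)))
      = (2 : ℝ) • checkerboard x := by
    ext i j
    rw [Finset.sum_apply, ← Finset.sum_mul, sum_intUnits_pow]
    simp only [checkerboard, Matrix.smul_apply, Matrix.of_apply, smul_eq_mul]
    split_ifs <;> simp
  rw [h2]
  exact (det_smul _ _).trans (by simp)

/-- The permutations of `Fin n` that preserve the parity of every index. -/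
def parityPerms (n : ℕ) : Finset (Equiv.Perm (Fin n)) :=
  univ.filter fun σ => ∀ i, Even ((σ i : ℕ) + i)

theorem parityPerms_card_ne_zero (n : ℕ) : (parityPerms n).card ≠ 0 :=
  Finset.card_ne_zero_of_mem (a := 1) (by simp [parityPerms])

/-- Up to constants, the sum of `Δ(ε x)²` over all signs is the symmetrization of the squared
checkerboard determinant. -/
theorem sum_sq_det_vandermonde_signFlip {n : ℕ} (x : Fin n → ℝ) :
    (parityPerms n).card * ∑ ε : Fin n → ℤˣ, (vandermonde (signFlip ε x)).det ^ 2
      = 2 ^ n * ∑ σ : Equiv.Perm (Fin n), (checkerboard (x ∘ σ)).det ^ 2 := by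
  -- both sides are expanded over pairs of permutations with the same parity pattern
  let T : Equiv.Perm (Fin n) → Equiv.Perm (Fin n) → ℝ := fun π ρ =>
    (Equiv.Perm.sign π : ℤ) * (Equiv.Perm.sign ρ : ℤ) * ∏ i, x i ^ ((π i : ℕ) + ρ i)
  have hL : ∑ ε : Fin n → ℤˣ, (vandermonde (signFlip ε x)).det ^ 2
      = ∑ π, ∑ ρ, if ∀ i, Even ((π i : ℕ) + ρ i) then 2 ^ n * T π ρ else 0 := by
    have : ∀ ε : Fin n → ℤˣ, (vandermonde (signFlip ε x)).det ^ 2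
        = ∑ π, ∑ ρ, T π ρ * ∏ i, ((ε i : ℤ) : ℝ) ^ ((π i : ℕ) + ρ i) := by
      intro ε
      rw [← det_transpose, det_apply', sq, Finset.sum_mul_sum]
      refine Finset.sum_congr rfl fun π _ => Finset.sum_congr rfl fun ρ _ => ?_
      simp only [T, transpose_apply, vandermonde_apply, signFlip, mul_pow, Finset.prod_mul_distrib,
        pow_add]
      ring
    simp_rw [this]
    rw [Finset.sum_comm]
    refine Finset.sum_congr rfl fun π _ => ?_
    rw [Finset.sum_comm]
    refine Finset.sum_congr rfl fun ρ _ => ?_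
    rw [← Finset.mul_sum]
    have hp : ∑ ε : Fin n → ℤˣ, ∏ i, ((ε i : ℤ) : ℝ) ^ ((π i : ℕ) + ρ i)
        = ∏ i, ∑ e : ℤˣ, ((e : ℤ) : ℝ) ^ ((π i : ℕ) + ρ i) := by
      rw [Finset.prod_univ_sum, Fintype.piFinset_univ]
    rw [hp]
    simp_rw [sum_intUnits_pow]
    split_ifs with h
    · simp [h, mul_comm]
    · push Not at h
      obtain ⟨i, hi⟩ := h
      rw [Finset.prod_eq_zero (Finset.mem_univ i) (if_neg hi), mul_zero]
  have hR : ∑ σ : Equiv.Perm (Fin n), (checkerboard (x ∘ σ)).det ^ 2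
      = ∑ σ : Equiv.Perm (Fin n), ∑ π, ∑ ρ,
        if (∀ i, Even ((π i : ℕ) + σ i)) ∧ (∀ i, Even ((ρ i : ℕ) + σ i)) then T π ρ else 0 := by
    have hdet : ∀ σ : Equiv.Perm (Fin n), (checkerboard (x ∘ σ)).det
        = (Equiv.Perm.sign σ : ℤ) * ∑ π : Equiv.Perm (Fin n), (Equiv.Perm.sign π : ℤ) *
          ∏ i, if Even ((π i : ℕ) + (σ⁻¹ : Equiv.Perm (Fin n)) i) then x i ^ (π i : ℕ) else 0 := by
      intro σ
      have hM : (checkerboard (x ∘ σ)).transpose = ((of fun i j : Fin n =>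
          if Even ((i : ℕ) + (σ⁻¹ : Equiv.Perm (Fin n)) j) then x j ^ (i : ℕ) else 0).submatrix
          id σ) := by
        ext i j
        simp [checkerboard, add_comm]
      rw [← det_transpose, hM, det_permute', det_apply']
      simp
    rw [← Equiv.sum_comp (Equiv.inv (Equiv.Perm (Fin n)))]
    refine Finset.sum_congr rfl fun σ _ => ?_
    rw [hdet, mul_pow]
    have hs : (((Equiv.Perm.sign ((Equiv.inv _) σ) : ℤˣ) : ℤ) : ℝ) ^ 2 = 1 := by
      rw [← Int.cast_pow, ← Units.val_pow_eq_pow_val, Int.units_sq]; simp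
    rw [hs, one_mul, sq, Finset.sum_mul_sum]
    refine Finset.sum_congr rfl fun π _ => Finset.sum_congr rfl fun ρ _ => ?_
    rw [show ∀ a b c d : ℝ, a * b * (c * d) = a * c * (b * d) by intros; ring]
    rw [Finset.prod_ite_zero, Finset.prod_ite_zero]
    simp only [T, Equiv.inv_apply, inv_inv, Finset.mem_univ, forall_true_left]
    by_cases h1 : ∀ i, Even ((π i : ℕ) + σ i) <;> by_cases h2 : ∀ i, Even ((ρ i : ℕ) + σ i) <;>
      simp [h1, h2, Finset.prod_mul_distrib, pow_add]
  -- `σ ↦ σ π⁻¹` maps the permutations with the parity pattern of `π` onto those preserving parity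
  have hcard : ∀ π : Equiv.Perm (Fin n),
      (univ.filter fun σ : Equiv.Perm (Fin n) => ∀ i, Even ((π i : ℕ) + σ i)).card
        = (parityPerms n).card := by
    intro π
    refine Finset.card_bij' (fun σ _ => σ * π⁻¹) (fun τ _ => τ * π) ?_ ?_ ?_ ?_
    · intro σ hσ
      simp only [parityPerms, Finset.mem_filter, Finset.mem_univ, true_and] at hσ ⊢
      intro i
      have := hσ ((π⁻¹ : Equiv.Perm _) i)
      simpa [add_comm] using this
    · intro τ hτ
      simp only [parityPerms, Finset.mem_filter, Finset.mem_univ, true_and] at hτ ⊢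
      intro i
      simpa [add_comm] using hτ (π i)
    · intro σ _; simp
    · intro σ _; simp
  rw [Finset.sum_comm] at hR
  rw [hL, hR, Finset.mul_sum, Finset.mul_sum]
  refine Finset.sum_congr rfl fun π _ => ?_
  rw [Finset.sum_comm, Finset.mul_sum, Finset.mul_sum]
  refine Finset.sum_congr rfl fun ρ _ => ?_
  by_cases h : ∀ i, Even ((π i : ℕ) + ρ i)
  · have hiff : ∀ σ : Equiv.Perm (Fin n),
        ((∀ i, Even ((π i : ℕ) + σ i)) ∧ (∀ i, Even ((ρ i : ℕ) + σ i)))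
          ↔ ∀ i, Even ((π i : ℕ) + σ i) := by
      refine fun σ => ⟨fun h' => h'.1, fun h' => ⟨h', fun i => ?_⟩⟩
      have h1 := h i
      have h2 := h' i
      grind
    simp_rw [hiff]
    rw [if_pos h, ← Finset.sum_filter, Finset.sum_const, hcard π, nsmul_eq_mul]
    ring
  · have hno : ∀ σ : Equiv.Perm (Fin n),
        ¬ ((∀ i, Even ((π i : ℕ) + σ i)) ∧ (∀ i, Even ((ρ i : ℕ) + σ i))) := by
      rintro σ ⟨h1, h2⟩
      refine h fun i => ?_
      have h1 := h1 i
      have h2 := h2 i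
      grind
    simp [h, hno]

/-- The matrix of the powers `s_i ^ (2 j + c)`: even powers for `c = 0`, odd powers for `c = 1`. -/
def powerMatrix {q : ℕ} (c : ℕ) (s : Fin q → ℝ) : Matrix (Fin q) (Fin q) ℝ :=
  Matrix.of fun i j => s i ^ (2 * (j : ℕ) + c)

theorem det_powerMatrix {q : ℕ} (c : ℕ) (s : Fin q → ℝ) :
    (powerMatrix c s).det = (∏ i, s i ^ c) * (vandermonde fun i => s i ^ 2).det := by
  rw [← det_mul_column]
  refine congrArg Matrix.det ?_
  ext i j
  simp [powerMatrix, vandermonde_apply, ← pow_mul, ← pow_add, add_comm]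

theorem det_powerMatrix_nonneg {q : ℕ} (c : ℕ) {s : Fin q → ℝ} (hs : ∀ i, 0 ≤ s i)
    (hmono : Monotone s) : 0 ≤ (powerMatrix c s).det := by
  rw [det_powerMatrix, det_vandermonde]
  refine mul_nonneg (Finset.prod_nonneg fun i _ => pow_nonneg (hs i) _)
    (Finset.prod_nonneg fun i _ => Finset.prod_nonneg fun j hj => ?_)
  have := pow_le_pow_left₀ (hs i) (hmono (Finset.mem_Ioi.1 hj).le) 2
  linarith

/-- The partition of `Fin N`, `N = 2 q + r` with `r < 2`, into the `q` indices that are congruent to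
`N` modulo 2 and the `p = q + r` others. In a tuple listed in increasing order, the former are the
locations of the 2nd, 4th, … largest entry, as the largest entry has the index `N - 1`. -/
def paritySplit {q r p N : ℕ} (hr : r < 2) (hp : p = q + r) (hN : N = 2 * q + r) :
    Fin q ⊕ Fin p ≃ Fin N where
  toFun := Sum.elim (fun j => ⟨2 * j + r, by omega⟩) (fun k => ⟨2 * k + 1 - r, by omega⟩)
  invFun i := if h : (i : ℕ) % 2 = r then Sum.inl ⟨i / 2, by omega⟩ else Sum.inr ⟨i / 2, by omega⟩
  left_inv := by
    rintro (j | k)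
    · have h : (2 * (j : ℕ) + r) % 2 = r := by omega
      simp only [Sum.elim_inl, h, ↓reduceDIte]
      exact congrArg Sum.inl (Fin.ext (by show _ / 2 = _; omega))
    · have h : ¬ (2 * (k : ℕ) + 1 - r) % 2 = r := by omega
      simp only [Sum.elim_inr, h, ↓reduceDIte]
      exact congrArg Sum.inr (Fin.ext (by show _ / 2 = _; omega))
  right_inv := by
    intro i
    by_cases h : (i : ℕ) % 2 = r
    · simp only [h, dite_true, Sum.elim_inl]
      ext; simp only; omega
    · simp only [h, dite_false, Sum.elim_inr]
      ext; simp only; omega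

@[simp] theorem paritySplit_inl {q r p N : ℕ} (hr : r < 2) (hp : p = q + r) (hN : N = 2 * q + r)
    (j : Fin q) : (paritySplit hr hp hN (Sum.inl j) : ℕ) = 2 * j + r := rfl

@[simp] theorem paritySplit_inr {q r p N : ℕ} (hr : r < 2) (hp : p = q + r) (hN : N = 2 * q + r)
    (k : Fin p) : (paritySplit hr hp hN (Sum.inr k) : ℕ) = 2 * k + 1 - r := rfl

theorem det_checkerboard {q r p N : ℕ} (hr : r < 2) (hp : p = q + r) (hN : N = 2 * q + r)
    (x : Fin N → ℝ) :
    (checkerboard x).det = (powerMatrix r fun j => x (paritySplit hr hp hN (Sum.inl j))).det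
      * (powerMatrix (1 - r) fun k => x (paritySplit hr hp hN (Sum.inr k))).det := by
  rw [← det_submatrix_equiv_self (paritySplit hr hp hN), ← det_fromBlocks_zero₂₁ _ 0]
  refine congrArg Matrix.det ?_
  ext (i | i) (j | j)
  · have : Even (2 * (i : ℕ) + r + (2 * j + r)) := ⟨i + j + r, by ring⟩
    simp [checkerboard, powerMatrix, this]
  · have : ¬ Even (2 * (i : ℕ) + r + (2 * j + 1 - r)) := by
      rw [Nat.not_even_iff]; omega
    simp [checkerboard, this]
  · have : ¬ Even (2 * (i : ℕ) + 1 - r + (2 * j + r)) := by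
      rw [Nat.not_even_iff]; omega
    simp [checkerboard, this]
  · have : Even (2 * (i : ℕ) + 1 - r + (2 * j + (1 - r))) := by
      rw [Nat.even_iff]; omega
    have h2 : 2 * (j : ℕ) + 1 - r = 2 * j + (1 - r) := by omega
    simp [checkerboard, powerMatrix, this, h2]

end RandomEnsemble

/-! ### Order statistics, superposition and fundamental domains -/

namespace RandomEnsemble
open Matrix Finset

theorem decreasing_comp_perm {n : ℕ} (x : Fin n → ℝ) (σ : Equiv.Perm (Fin n)) :
    decreasing (x ∘ σ) = decreasing x := by
  funext i
  exact congrFun (Tuple.comp_perm_comp_sort_eq_comp_sort (f := x) (σ := σ)) i.rev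

theorem decreasing_of_monotone {n : ℕ} {x : Fin n → ℝ} (hx : Monotone x) :
    decreasing x = fun i => x i.rev := by
  funext i
  simp [decreasing, Tuple.sort_eq_refl_iff_monotone.2 hx]

theorem measurable_decreasing {n : ℕ} : Measurable (decreasing (n := n)) := by
  have hS : ∀ σ : Equiv.Perm (Fin n), MeasurableSet {x : Fin n → ℝ | Tuple.sort x = σ} := by
    intro σ
    have : {x : Fin n → ℝ | Tuple.sort x = σ} = ⋂ i, ⋂ j,
        {x | (i ≤ j → x (σ i) ≤ x (σ j)) ∧ (i < j → x (σ i) = x (σ j) → σ i < σ j)} := by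
      ext x
      rw [Set.mem_ofPred_eq, eq_comm, Tuple.eq_sort_iff]
      simp only [Monotone, Function.comp, Set.mem_iInter, Set.mem_ofPred_eq]
      exact ⟨fun h i j => ⟨fun hij => h.1 hij, fun hij => h.2 i j hij⟩,
        fun h => ⟨fun i j => (h i j).1, fun i j => (h i j).2⟩⟩
    rw [this]
    refine MeasurableSet.iInter fun i => MeasurableSet.iInter fun j => ?_
    refine MeasurableSet.inter ?_ ?_
    · exact MeasurableSet.imp (MeasurableSet.const _)
        (measurableSet_le (measurable_pi_apply _) (measurable_pi_apply _))
    · exact MeasurableSet.imp (MeasurableSet.const _) (MeasurableSet.imp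
        (measurableSet_eq_fun (measurable_pi_apply _) (measurable_pi_apply _))
        (MeasurableSet.const _))
  rw [measurable_pi_iff]
  intro i
  have : (fun x : Fin n → ℝ => decreasing x i)
      = fun x => ∑ σ : Equiv.Perm (Fin n),
        Set.indicator {x : Fin n → ℝ | Tuple.sort x = σ} (fun x => x (σ i.rev)) x := by
    funext x
    rw [Finset.sum_eq_single (Tuple.sort x)]
    · simp [decreasing]
    · intro σ _ hσ
      simp [Set.indicator, hσ.symm]
    · simp
  rw [this]
  exact Finset.measurable_fun_sum _ fun σ _ => (measurable_pi_apply _).indicator (hS σ)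

theorem measurable_singularValues {n : ℕ} : Measurable (singularValues (n := n)) :=
  measurable_decreasing.comp (by fun_prop)

theorem measurable_even {n : ℕ} : Measurable (even (n := n)) := by
  unfold even; fun_prop

theorem superpose_eq_decreasing {k l n : ℕ} (h : k + l = n) (s : Fin k → ℝ) (t : Fin l → ℝ) :
    superpose h s t = decreasing fun i => Fin.append s t (Fin.cast h.symm i) := by
  subst h; rfl

theorem measurable_superpose {k l n : ℕ} (h : k + l = n) :
    Measurable fun p : (Fin k → ℝ) × (Fin l → ℝ) => superpose h p.1 p.2 := by
  simp_rw [superpose_eq_decreasing]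
  refine measurable_decreasing.comp (measurable_pi_iff.2 fun i => ?_)
  refine Fin.addCases (fun j => ?_) (fun j => ?_) (Fin.cast h.symm i)
  · simp only [Fin.append_left]; fun_prop
  · simp only [Fin.append_right]; fun_prop

/-- The tuple indexed by `η` that is composed of `s` and `t` along `e`. -/
def join {ι κ η : Type*} (e : ι ⊕ κ ≃ η) (s : ι → ℝ) (t : κ → ℝ) : η → ℝ :=
  fun i => Sum.elim s t (e.symm i)

@[simp] theorem join_inl {ι κ η : Type*} (e : ι ⊕ κ ≃ η) (s : ι → ℝ) (t : κ → ℝ) (i : ι) :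
    join e s t (e (Sum.inl i)) = s i := by simp [join]

@[simp] theorem join_inr {ι κ η : Type*} (e : ι ⊕ κ ≃ η) (s : ι → ℝ) (t : κ → ℝ) (i : κ) :
    join e s t (e (Sum.inr i)) = t i := by simp [join]

/-- Superposition only sees the multiset of the points, so neither the order within the two parts
nor the way in which they are joined matters. -/
theorem superpose_decreasing_decreasing {k l n : ℕ} (h : k + l = n) (e : Fin k ⊕ Fin l ≃ Fin n)
    (s : Fin k → ℝ) (t : Fin l → ℝ) :
    superpose h (decreasing s) (decreasing t) = decreasing (join e s t) := by
  let σ : Equiv.Perm (Fin n) := ((finCongr h.symm).trans finSumFinEquiv.symm).trans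
    ((Equiv.sumCongr (Fin.revPerm.trans (Tuple.sort s)) (Fin.revPerm.trans (Tuple.sort t))).trans e)
  rw [superpose_eq_decreasing, ← decreasing_comp_perm (join e s t) σ]
  congr 1
  funext i
  obtain ⟨j, rfl⟩ := (finCongr h).surjective i
  refine Fin.addCases (fun a => ?_) (fun a => ?_) j
  · simp [σ, decreasing]
  · simp [σ, decreasing]

/-- If almost every point is moved into `S` by exactly one of the measure preserving maps `T i`,
then an integral over the whole space folds to one over the fundamental domain `S`. -/
theorem lintegral_eq_setLIntegral_sum {α ι : Type*} [MeasurableSpace α] [Fintype ι]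
    {μ : Measure α} {T T' : ι → α → α} (hT : ∀ i, MeasurePreserving (T i) μ μ)
    (hT' : ∀ i, Measurable (T' i)) (hinv : ∀ i, Function.LeftInverse (T' i) (T i)) {S : Set α}
    (hS : MeasurableSet S) (hdom : ∀ᵐ x ∂μ, ∃! i, T i x ∈ S) {f : α → ENNReal}
    (hf : Measurable f) :
    ∫⁻ x, f x ∂μ = ∫⁻ x in S, ∑ i, f (T' i x) ∂μ := by
  have h1 : ∀ i, ∫⁻ x, S.indicator (fun y => f (T' i y)) (T i x) ∂μ
      = ∫⁻ x in S, f (T' i x) ∂μ := by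
    intro i
    have hm : Measurable (S.indicator fun y => f (T' i y)) := (hf.comp (hT' i)).indicator hS
    rw [(hT i).lintegral_comp hm, lintegral_indicator hS]
  rw [lintegral_finsetSum _ (f := fun i x => f (T' i x)) (fun i _ => hf.comp (hT' i))]
  simp_rw [← h1]
  rw [← lintegral_finsetSum _
    (f := fun i x => S.indicator (fun y => f (T' i y)) (T i x)) (fun i _ =>
    ((hf.comp (hT' i)).indicator hS).comp (hT i).measurable)]
  refine lintegral_congr_ae ?_
  filter_upwards [hdom] with x ⟨i, hi, huniq⟩
  rw [Finset.sum_eq_single i]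
  · simp [hi, hinv i x]
  · intro j _ hj
    rw [Set.indicator_of_notMem fun h => hj (huniq j h)]
  · simp

/-- The tuples all of whose entries are positive. -/
def positiveOrthant (n : ℕ) : Set (Fin n → ℝ) := {x | ∀ i, 0 < x i}

theorem measurableSet_positiveOrthant (n : ℕ) : MeasurableSet (positiveOrthant n) := by
  simp only [positiveOrthant, Set.ofPred_forall]
  exact MeasurableSet.iInter fun i => measurableSet_lt measurable_const (measurable_pi_apply i)

theorem measurableSet_strictMono (n : ℕ) : MeasurableSet {x : Fin n → ℝ | StrictMono x} := by
  simp only [StrictMono, Set.ofPred_forall]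
  exact MeasurableSet.iInter fun i => MeasurableSet.iInter fun j => MeasurableSet.iInter fun _ =>
    measurableSet_lt (measurable_pi_apply i) (measurable_pi_apply j)

theorem measurePreserving_signFlip {n : ℕ} (ε : Fin n → ℤˣ) :
    MeasurePreserving (signFlip ε) volume volume := by
  refine measurePreserving_pi (fun _ => (volume : Measure ℝ)) (fun _ => (volume : Measure ℝ))
    (f := fun i y => ((ε i : ℤ) : ℝ) * y) fun i => ?_
  rcases Int.units_eq_one_or (ε i) with h | h
  · have : (fun y : ℝ => ((ε i : ℤ) : ℝ) * y) = id := by funext y; simp [h]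
    rw [this]
    exact MeasurePreserving.id (volume : Measure ℝ)
  · simpa [h] using Measure.measurePreserving_neg (volume : Measure ℝ)

theorem signFlip_signFlip {n : ℕ} (ε : Fin n → ℤˣ) (x : Fin n → ℝ) :
    signFlip ε (signFlip ε x) = x := by
  funext i
  rcases Int.units_eq_one_or (ε i) with h | h <;> simp [signFlip, h]

theorem abs_signFlip {n : ℕ} (ε : Fin n → ℤˣ) (x : Fin n → ℝ) (i : Fin n) :
    |signFlip ε x i| = |x i| := by
  rcases Int.units_eq_one_or (ε i) with h | h <;> simp [signFlip, h]

theorem ae_ne_zero {n : ℕ} : ∀ᵐ x : Fin n → ℝ, ∀ i, x i ≠ 0 := by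
  rw [ae_all_iff]
  intro i
  exact (Measure.quasiMeasurePreserving_eval (fun _ : Fin n => (volume : Measure ℝ)) i).ae
    (Measure.ae_ne volume 0)

theorem ae_injective {n : ℕ} : ∀ᵐ x : Fin n → ℝ, Function.Injective x := by
  have : ∀ i j : Fin n, i ≠ j → ∀ᵐ x : Fin n → ℝ, x i ≠ x j := by
    intro i j hij
    let φ : (Fin n → ℝ) →ₗ[ℝ] ℝ :=
      (LinearMap.proj i : (Fin n → ℝ) →ₗ[ℝ] ℝ) - LinearMap.proj j
    have hφ : LinearMap.ker φ ≠ ⊤ := by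
      intro h
      have := LinearMap.ker_eq_top.1 h
      have h1 := congrArg (fun ψ : (Fin n → ℝ) →ₗ[ℝ] ℝ => ψ (Pi.single i 1)) this
      simp [φ, Pi.single_eq_of_ne hij.symm] at h1
    have h0 := Measure.addHaar_submodule (volume : Measure (Fin n → ℝ)) _ hφ
    rw [ae_iff]
    convert h0 using 2
    ext x
    simp [φ, sub_eq_zero]
  have h2 : ∀ᵐ x : Fin n → ℝ, ∀ i j : Fin n, i ≠ j → x i ≠ x j := by
    rw [ae_all_iff]; intro i
    rw [ae_all_iff]; intro j
    by_cases h : i = j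
    · simp [h]
    · filter_upwards [this i j h] with x hx _ using hx
  filter_upwards [h2] with x hx i j hij
  by_contra h
  exact hx i j h hij

theorem lintegral_eq_positiveOrthant {n : ℕ} {f : (Fin n → ℝ) → ENNReal} (hf : Measurable f) :
    ∫⁻ x, f x = ∫⁻ x in positiveOrthant n, ∑ ε : Fin n → ℤˣ, f (signFlip ε x) := by
  refine lintegral_eq_setLIntegral_sum measurePreserving_signFlip
    (fun ε => (measurePreserving_signFlip ε).measurable) signFlip_signFlip
    (measurableSet_positiveOrthant n) ?_ hf
  filter_upwards [ae_ne_zero] with x hx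
  refine ⟨fun i => if 0 < x i then 1 else -1, fun i => ?_, fun ε hε => funext fun i => ?_⟩
  · rcases lt_or_gt_of_ne (hx i) with h | h
    · simp [signFlip, h, h.not_gt]
    · simp [signFlip, h]
  · have := hε i
    rcases Int.units_eq_one_or (ε i) with h | h <;> simp [signFlip, h] at this
    · simp [h, this]
    · simp [h, this.not_gt]

theorem measurePreserving_comp_perm {n : ℕ} (σ : Equiv.Perm (Fin n)) :
    MeasurePreserving (fun x : Fin n → ℝ => x ∘ σ) volume volume := by
  have := volume_measurePreserving_piCongrLeft (fun _ : Fin n => ℝ) σ.symm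
  convert this using 1
  funext x i
  obtain ⟨j, rfl⟩ := σ.symm.surjective i
  rw [MeasurableEquiv.piCongrLeft_apply_apply]
  simp

theorem lintegral_eq_strictMono {n : ℕ} {f : (Fin n → ℝ) → ENNReal} (hf : Measurable f) :
    ∫⁻ x, f x = ∫⁻ x in {x | StrictMono x}, ∑ σ : Equiv.Perm (Fin n), f (x ∘ σ) := by
  rw [lintegral_eq_setLIntegral_sum (T := fun (σ : Equiv.Perm (Fin n)) x => x ∘ σ)
    (T' := fun σ x => x ∘ (σ⁻¹ : Equiv.Perm _))
    (fun σ => measurePreserving_comp_perm _)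
    (fun σ => (measurePreserving_comp_perm _).measurable) (fun σ x => by funext i; simp)
    (measurableSet_strictMono n) ?_ hf]
  · refine lintegral_congr fun x => ?_
    exact Equiv.sum_comp (Equiv.inv (Equiv.Perm (Fin n))) fun σ => f (x ∘ σ)
  filter_upwards [ae_injective] with x hx
  refine ⟨Tuple.sort x, ?_, fun σ hσ => ?_⟩
  · exact (Tuple.monotone_sort x).strictMono_of_injective (hx.comp (Tuple.sort x).injective)
  · have := Tuple.unique_monotone (StrictMono.monotone hσ) (Tuple.monotone_sort x)
    exact Equiv.ext fun i => hx (congrFun this i)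

theorem lintegral_join {q p N : ℕ} (e : Fin q ⊕ Fin p ≃ Fin N) {f : (Fin N → ℝ) → ENNReal}
    (hf : Measurable f) : ∫⁻ x, f x = ∫⁻ s, ∫⁻ t, f (join e s t) := by
  have h1 := volume_measurePreserving_piCongrLeft (fun _ : Fin N => ℝ) e
  have h2 := volume_measurePreserving_sumPiEquivProdPi_symm (fun _ : Fin q ⊕ Fin p => ℝ)
  have h3 : ∀ z : (Fin q → ℝ) × (Fin p → ℝ), MeasurableEquiv.piCongrLeft (fun _ : Fin N => ℝ) e
      ((MeasurableEquiv.sumPiEquivProdPi (fun _ : Fin q ⊕ Fin p => ℝ)).symm z)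
        = join e z.1 z.2 := by
    intro z
    funext i
    obtain ⟨j, rfl⟩ := e.surjective i
    rw [MeasurableEquiv.piCongrLeft_apply_apply]
    rcases j with j | j <;> simp [MeasurableEquiv.sumPiEquivProdPi, Equiv.sumPiEquivProdPi]
  rw [← (h1.comp h2).lintegral_comp hf, Measure.volume_eq_prod, lintegral_prod]
  · simp only [Function.comp, h3]
  · exact (hf.comp (h1.comp h2).measurable).aemeasurable

end RandomEnsemble

/-! ### Eigenvalue measures and the singular values of the unitary ensemble -/

namespace RandomEnsemble
open Matrix Finset

theorem continuous_det_vandermonde {n : ℕ} :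
    Continuous fun x : Fin n → ℝ => (vandermonde x).det := by
  simp_rw [det_vandermonde]; fun_prop

theorem continuous_det_powerMatrix {q : ℕ} (c : ℕ) :
    Continuous fun s : Fin q → ℝ => (powerMatrix c s).det := by
  simp_rw [det_powerMatrix, det_vandermonde]; fun_prop

theorem continuous_det_checkerboard {n : ℕ} :
    Continuous fun x : Fin n → ℝ => (checkerboard x).det := by
  refine Continuous.matrix_det (continuous_matrix fun i j => ?_)
  simp only [checkerboard, of_apply]
  split_ifs <;> fun_prop

theorem measurable_prod_weight {n : ℕ} {w : ℝ → ℝ} (hw : Measurable w) :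
    Measurable fun x : Fin n → ℝ => ∏ k, w (x k) :=
  Finset.measurable_fun_prod _ fun k _ => hw.comp (measurable_pi_apply k)

theorem measurable_eigenvalueDensity {n : ℕ} (β : ℕ) {w : ℝ → ℝ} (hw : Measurable w) :
    Measurable fun x : Fin n → ℝ => eigenvalueDensity β w x :=
  (measurable_prod_weight hw).mul
    ((measurable_norm.comp continuous_det_vandermonde.measurable).pow_const β)

theorem lintegral_weightedMeasure {n : ℕ} (β : ℕ) {w : ℝ → ℝ} (hw : Measurable w)
    {f : (Fin n → ℝ) → ENNReal} (hf : Measurable f) :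
    ∫⁻ x, f x ∂(weightedMeasure β w n)
      = ∫⁻ x, f x * ENNReal.ofReal (eigenvalueDensity β w x) := by
  rw [weightedMeasure, lintegral_withDensity_eq_lintegral_mul _
    (measurable_eigenvalueDensity β hw).ennreal_ofReal hf]
  simp [mul_comm]

theorem weightedMeasure_univ_ne_zero {n : ℕ} (β : ℕ) {w : ℝ → ℝ} (hw : Measurable w)
    (hpos : ∀ x ∈ Set.Ioo (0 : ℝ) 1, 0 < w x) : weightedMeasure β w n Set.univ ≠ 0 := by
  have hm := (measurable_eigenvalueDensity (n := n) β hw).ennreal_ofReal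
  rw [weightedMeasure, withDensity_apply _ MeasurableSet.univ, Measure.restrict_univ,
    ← pos_iff_ne_zero, lintegral_pos_iff_support hm]
  have hbox : 0 < (volume : Measure (Fin n → ℝ)) (Set.univ.pi fun _ => Set.Ioo (0 : ℝ) 1) := by
    rw [volume_pi_pi]; simp
  refine hbox.trans_le (measure_mono_ae ?_)
  filter_upwards [ae_injective] with x hx hbx
  have h1 : ∀ i, 0 < w (x i) := fun i => hpos _ (hbx i trivial)
  have h2 : (vandermonde x).det ≠ 0 := det_vandermonde_ne_zero_iff.2 hx
  refine (ENNReal.ofReal_pos.2 ?_).ne'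
  exact mul_pos (Finset.prod_pos fun i _ => h1 i) (pow_pos (abs_pos.2 h2) _)

theorem integrable_prod_weight_mul_prod_pow {n : ℕ} {w : ℝ → ℝ} (m : Fin n → ℕ)
    (h : ∀ i, Integrable fun x => w x * x ^ m i) :
    Integrable fun x : Fin n → ℝ => (∏ i, w (x i)) * ∏ i, x i ^ m i := by
  simp_rw [← Finset.prod_mul_distrib]
  exact Integrable.fintype_prod (f := fun i x => w x * x ^ m i) h

theorem integrable_eigenvalueDensity_one {n : ℕ} {w : ℝ → ℝ} (hnn : ∀ x, 0 ≤ w x)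
    (h : ∀ k < n, Integrable fun x => w x * x ^ k) :
    Integrable fun x : Fin n → ℝ => eigenvalueDensity 1 w x := by
  have : Integrable fun x : Fin n → ℝ => (∏ i, w (x i)) * (vandermonde x).det := by
    have hdet : ∀ x : Fin n → ℝ, (∏ i, w (x i)) * (vandermonde x).det
        = ∑ π : Equiv.Perm (Fin n), ((Equiv.Perm.sign π : ℤ) : ℝ) *
          ((∏ i, w (x i)) * ∏ i, x i ^ (π i : ℕ)) := by
      intro x
      rw [← det_transpose, det_apply', Finset.mul_sum]
      refine Finset.sum_congr rfl fun π _ => ?_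
      simp only [transpose_apply, vandermonde_apply]
      ring
    simp_rw [hdet]
    refine integrable_finsetSum _ fun π _ => Integrable.const_mul ?_ _
    exact integrable_prod_weight_mul_prod_pow (fun i => (π i : ℕ)) fun i => h _ (π i).2
  refine this.abs.congr (Filter.Eventually.of_forall fun x => ?_)
  simp only [eigenvalueDensity, pow_one]
  rw [abs_mul, abs_of_nonneg (Finset.prod_nonneg fun i _ => hnn _)]

theorem integrable_eigenvalueDensity_two {n : ℕ} {w : ℝ → ℝ}
    (h : ∀ k, k + 2 ≤ 2 * n → Integrable fun x => w x * x ^ k) :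
    Integrable fun x : Fin n → ℝ => eigenvalueDensity 2 w x := by
  simp only [eigenvalueDensity, sq_abs]
  have : ∀ x : Fin n → ℝ, (∏ i, w (x i)) * (vandermonde x).det ^ 2
      = ∑ π : Equiv.Perm (Fin n), ∑ ρ : Equiv.Perm (Fin n),
        ((Equiv.Perm.sign π : ℤ) * (Equiv.Perm.sign ρ : ℤ) : ℝ) *
          ((∏ i, w (x i)) * ∏ i, x i ^ ((π i : ℕ) + ρ i)) := by
    intro x
    rw [← det_transpose, det_apply', sq, Finset.sum_mul_sum, Finset.mul_sum]
    refine Finset.sum_congr rfl fun π _ => ?_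
    rw [Finset.mul_sum]
    refine Finset.sum_congr rfl fun ρ _ => ?_
    simp only [transpose_apply, vandermonde_apply, Finset.prod_mul_distrib, pow_add]
    ring
  simp_rw [this]
  refine integrable_finsetSum _ fun π _ => integrable_finsetSum _ fun ρ _ =>
    Integrable.const_mul ?_ _
  refine integrable_prod_weight_mul_prod_pow (fun i => (π i : ℕ) + ρ i) fun i => h _ ?_
  have := (π i).2
  have := (ρ i).2
  omega

theorem weightedMeasure_univ_ne_top {n β : ℕ} {w : ℝ → ℝ}
    (h : Integrable fun x : Fin n → ℝ => eigenvalueDensity β w x) :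
    weightedMeasure β w n Set.univ ≠ ⊤ := by
  rw [weightedMeasure, withDensity_apply _ MeasurableSet.univ, Measure.restrict_univ]
  exact h.lintegral_lt_top.ne

theorem isProbabilityMeasure_eigenvalueLaw {n β : ℕ} {w : ℝ → ℝ} (hw : Measurable w)
    (hpos : ∀ x ∈ Set.Ioo (0 : ℝ) 1, 0 < w x)
    (h : Integrable fun x : Fin n → ℝ => eigenvalueDensity β w x) :
    IsProbabilityMeasure (eigenvalueLaw β w n) := by
  constructor
  rw [eigenvalueLaw, Measure.smul_apply, smul_eq_mul]
  exact ENNReal.inv_mul_cancel (weightedMeasure_univ_ne_zero β hw hpos)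
    (weightedMeasure_univ_ne_top h)

/-- The density `∏ w(s_j) · det(s_j ^ (2 k + c))²` on the positive orthant, without normalization.
For even `w` and `c = 0, 1` these describe the two independent components of the singular values
of a unitary ensemble. -/
noncomputable def parityDensity (w : ℝ → ℝ) (c : ℕ) {q : ℕ} (s : Fin q → ℝ) : ENNReal :=
  (positiveOrthant q).indicator
    (fun s => ENNReal.ofReal ((∏ j, w (s j)) * (powerMatrix c s).det ^ 2)) s

theorem measurable_parityDensity {w : ℝ → ℝ} (hw : Measurable w) (c : ℕ) {q : ℕ} :
    Measurable (parityDensity w c (q := q)) :=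
  Measurable.indicator ((measurable_prod_weight hw).mul
    ((continuous_det_powerMatrix c).measurable.pow_const 2)).ennreal_ofReal
    (measurableSet_positiveOrthant q)

theorem apply_abs_of_even {w : ℝ → ℝ} (h : ∀ x, w (-x) = w x) (x : ℝ) : w |x| = w x := by
  rcases abs_choice x with hx | hx <;> simp [hx, h]

theorem prod_weight_signFlip {n : ℕ} {w : ℝ → ℝ} (h : ∀ x, w (-x) = w x) (ε : Fin n → ℤˣ)
    (x : Fin n → ℝ) : ∏ k, w (signFlip ε x k) = ∏ k, w (x k) := by
  refine Finset.prod_congr rfl fun k _ => ?_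
  rw [← apply_abs_of_even h, abs_signFlip, apply_abs_of_even h]

theorem singularValues_signFlip {n : ℕ} (ε : Fin n → ℤˣ) {x : Fin n → ℝ} (hx : ∀ i, 0 < x i) :
    singularValues (signFlip ε x) = decreasing x := by
  simp only [singularValues, abs_signFlip, abs_of_pos (hx _)]

/-- The sign changes fold the integral to the positive orthant, where `|x i| = x i`. -/
theorem lintegral_singularValues_weightedMeasure {n : ℕ} (β : ℕ) {w : ℝ → ℝ} (hw : Measurable w)
    (hnn : ∀ x, 0 ≤ w x) (heven : ∀ x, w (-x) = w x) {F : (Fin n → ℝ) → ENNReal}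
    (hF : Measurable F) :
    ∫⁻ x, F (singularValues x) ∂(weightedMeasure β w n)
      = ∫⁻ x in positiveOrthant n, F (decreasing x) * ENNReal.ofReal ((∏ k, w (x k)) *
          ∑ ε : Fin n → ℤˣ, |(vandermonde (signFlip ε x)).det| ^ β) := by
  have hF' : Measurable fun x : Fin n → ℝ => F (singularValues x) :=
    hF.comp measurable_singularValues
  rw [lintegral_weightedMeasure β hw hF', lintegral_eq_positiveOrthant
    (f := fun x => F (singularValues x) * ENNReal.ofReal (eigenvalueDensity β w x))
    (hF'.mul (measurable_eigenvalueDensity β hw).ennreal_ofReal)]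
  refine setLIntegral_congr_fun (measurableSet_positiveOrthant n) fun x hx => ?_
  rw [Finset.mul_sum, ENNReal.ofReal_sum_of_nonneg, Finset.mul_sum]
  · refine Finset.sum_congr rfl fun ε _ => ?_
    rw [singularValues_signFlip ε hx, eigenvalueDensity, prod_weight_signFlip heven]
  · intro ε _
    exact mul_nonneg (Finset.prod_nonneg fun k _ => hnn _) (by positivity)

theorem prod_weight_perm {n : ℕ} (w : ℝ → ℝ) (x : Fin n → ℝ) (σ : Equiv.Perm (Fin n)) :
    ∏ k, w ((x ∘ σ) k) = ∏ k, w (x k) :=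
  Equiv.prod_comp σ fun k => w (x k)

theorem comp_perm_mem_positiveOrthant {n : ℕ} (x : Fin n → ℝ) (σ : Equiv.Perm (Fin n)) :
    x ∘ σ ∈ positiveOrthant n ↔ x ∈ positiveOrthant n :=
  ⟨fun h i => by simpa using h (σ⁻¹ i), fun h i => h (σ i)⟩

/-- The singular values of the unitary ensemble are, up to normalization, the superposition of two
independent point processes with the densities `parityDensity w 0` and `parityDensity w 1`. -/
theorem exists_lintegral_unitary {n : ℕ} {w : ℝ → ℝ} (hw : Measurable w)
    (hnn : ∀ x, 0 ≤ w x) (heven : ∀ x, w (-x) = w x) :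
    ∃ A : ENNReal, ∀ F : (Fin n → ℝ) → ENNReal, Measurable F →
      ∫⁻ x, F (singularValues x) ∂(weightedMeasure 2 w n)
        = A * ∫⁻ s : Fin (n / 2) → ℝ, ∫⁻ t : Fin ((n + 1) / 2) → ℝ,
          F (superpose (half_add_half n) (decreasing s) (decreasing t)) *
            (parityDensity w (n % 2) s * parityDensity w ((n + 1) % 2) t) := by
  set K : ℝ := ((parityPerms n).card : ℝ) with hKdef
  have hK : 0 < K := by
    have := parityPerms_card_ne_zero n
    positivity
  refine ⟨ENNReal.ofReal (2 ^ n / K) * (Fintype.card (Equiv.Perm (Fin n)) : ENNReal),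
    fun F hF => ?_⟩
  let h : (Fin n → ℝ) → ENNReal := fun x => (positiveOrthant n).indicator (fun x =>
    F (decreasing x) * ENNReal.ofReal ((∏ k, w (x k)) * (checkerboard x).det ^ 2)) x
  have hh : Measurable h := Measurable.indicator ((hF.comp measurable_decreasing).mul
    ((measurable_prod_weight hw).mul
    (continuous_det_checkerboard.measurable.pow_const 2)).ennreal_ofReal)
    (measurableSet_positiveOrthant n)
  have hsum : ∫⁻ x, F (singularValues x) ∂(weightedMeasure 2 w n)
      = ∫⁻ x, ENNReal.ofReal (2 ^ n / K) * ∑ σ : Equiv.Perm (Fin n), h (x ∘ σ) := by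
    rw [lintegral_singularValues_weightedMeasure 2 hw hnn heven hF,
      ← lintegral_indicator (measurableSet_positiveOrthant n)]
    refine lintegral_congr fun x => ?_
    by_cases hx : x ∈ positiveOrthant n
    · have hx' : ∀ σ : Equiv.Perm (Fin n), x ∘ σ ∈ positiveOrthant n := fun σ =>
        (comp_perm_mem_positiveOrthant x σ).2 hx
      simp only [h, Set.indicator_of_mem hx, Set.indicator_of_mem (hx' _), decreasing_comp_perm,
        prod_weight_perm, sq_abs]
      have h0 : ∀ σ ∈ (univ : Finset (Equiv.Perm (Fin n))),
          0 ≤ (∏ k, w (x k)) * (checkerboard (x ∘ σ)).det ^ 2 := fun σ _ =>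
        mul_nonneg (Finset.prod_nonneg fun k _ => hnn _) (sq_nonneg _)
      rw [← Finset.mul_sum, ← ENNReal.ofReal_sum_of_nonneg h0, mul_left_comm,
        ← ENNReal.ofReal_mul (by positivity), ← Finset.mul_sum]
      congr 2
      have := sum_sq_det_vandermonde_signFlip x
      rw [← hKdef] at this
      field_simp
      linear_combination (∏ k, w (x k)) * this
    · have hx' : ∀ σ : Equiv.Perm (Fin n), x ∘ σ ∉ positiveOrthant n := fun σ =>
        fun h' => hx ((comp_perm_mem_positiveOrthant x σ).1 h')
      simp [h, hx, hx']
  have hperm : ∀ σ : Equiv.Perm (Fin n), ∫⁻ x, h (x ∘ σ) = ∫⁻ x, h x := fun σ =>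
    (measurePreserving_comp_perm σ).lintegral_comp hh
  have hhσ : ∀ σ : Equiv.Perm (Fin n), Measurable fun x : Fin n → ℝ => h (x ∘ σ) := fun σ =>
    hh.comp (measurePreserving_comp_perm σ).measurable
  rw [hsum, lintegral_const_mul _ (Finset.measurable_fun_sum _ fun σ _ => hhσ σ),
    lintegral_finsetSum _ fun σ _ => hhσ σ]
  simp_rw [hperm]
  rw [Finset.sum_const, Finset.card_univ, nsmul_eq_mul, ← mul_assoc]
  congr 1
  have hr : n % 2 < 2 := by omega
  -- the two parity blocks of the checkerboard determinant of order `n`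
  have hp : (n + 1) / 2 = n / 2 + n % 2 := by omega
  have hN : n = 2 * (n / 2) + n % 2 := by omega
  have hc : 1 - n % 2 = (n + 1) % 2 := by omega
  rw [lintegral_join (paritySplit hr hp hN) hh]
  refine lintegral_congr fun s => lintegral_congr fun t => ?_
  rw [superpose_decreasing_decreasing _ (paritySplit hr hp hN)]
  set e := paritySplit hr hp hN
  have hmem : join e s t ∈ positiveOrthant n
      ↔ s ∈ positiveOrthant (n / 2) ∧ t ∈ positiveOrthant ((n + 1) / 2) := by
    simp only [positiveOrthant, Set.mem_ofPred_eq]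
    rw [e.surjective.forall, Sum.forall]
    simp
  by_cases hs : s ∈ positiveOrthant (n / 2)
  · by_cases ht : t ∈ positiveOrthant ((n + 1) / 2)
    · simp only [h, parityDensity, Set.indicator_of_mem (hmem.2 ⟨hs, ht⟩),
        Set.indicator_of_mem hs, Set.indicator_of_mem ht]
      rw [← ENNReal.ofReal_mul (mul_nonneg (Finset.prod_nonneg fun k _ => hnn _) (sq_nonneg _)),
        det_checkerboard hr hp hN, ← e.prod_comp, Fintype.prod_sum_type, hc]
      simp only [e, join_inl, join_inr]
      congr 2
      ring
    · have : join e s t ∉ positiveOrthant n := fun h' => ht (hmem.1 h').2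
      simp [h, parityDensity, this, ht]
  · have : join e s t ∉ positiveOrthant n := fun h' => hs (hmem.1 h').1
    simp [h, parityDensity, this, hs]

end RandomEnsemble

/-! ### Tail moments and integration over interlacing points -/

namespace RandomEnsemble
open Matrix Finset

/-- The tail moment `∫_u^∞ w(t) t ^ k dt`. -/
noncomputable def tailMoment (w : ℝ → ℝ) (k : ℕ) (u : ℝ) : ℝ := ∫ t in Set.Ioi u, w t * t ^ k

/-- The open interval between `u k` and the next term of `u`; it is unbounded for the last index. -/
def cell {p : ℕ} (u : Fin p → ℝ) (k : Fin p) : Set ℝ :=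
  {y | u k < y ∧ ∀ h : (k : ℕ) + 1 < p, y < u ⟨k + 1, h⟩}

theorem cell_eq_Ioo {p : ℕ} (u : Fin p → ℝ) {k : Fin p} (h : (k : ℕ) + 1 < p) :
    cell u k = Set.Ioo (u k) (u ⟨k + 1, h⟩) := by
  ext y; simp [cell, h]

theorem cell_eq_Ioi {p : ℕ} (u : Fin p → ℝ) {k : Fin p} (h : ¬ (k : ℕ) + 1 < p) :
    cell u k = Set.Ioi (u k) := by
  ext y; simp [cell, h]

theorem measurableSet_cell {p : ℕ} (u : Fin p → ℝ) (k : Fin p) : MeasurableSet (cell u k) := by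
  by_cases h : (k : ℕ) + 1 < p
  · rw [cell_eq_Ioo u h]; exact measurableSet_Ioo
  · rw [cell_eq_Ioi u h]; exact measurableSet_Ioi

theorem setIntegral_cell {p : ℕ} {u : Fin p → ℝ} (hu : StrictMono u) (k : Fin p) {w : ℝ → ℝ}
    {m : ℕ} (hint : Integrable fun y => w y * y ^ m) :
    ∫ y in cell u k, w y * y ^ m = tailMoment w m (u k)
      - if h : (k : ℕ) + 1 < p then tailMoment w m (u ⟨k + 1, h⟩) else 0 := by
  by_cases h : (k : ℕ) + 1 < p
  · have hlt : u k < u ⟨k + 1, h⟩ := hu (Fin.mk_lt_mk.2 (Nat.lt_succ_self _) : k < ⟨k + 1, h⟩)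
    rw [cell_eq_Ioo u h, dif_pos h, tailMoment, tailMoment, ← Set.Ioc_union_Ioi_eq_Ioi hlt.le,
      setIntegral_union (Set.Ioc_disjoint_Ioi le_rfl) measurableSet_Ioi hint.integrableOn
        hint.integrableOn, integral_Ioc_eq_integral_Ioo]
    ring
  · rw [cell_eq_Ioi u h, dif_neg h, sub_zero, tailMoment]

/-- The integrals over the cells are differences of consecutive tail integrals, so the two matrices
differ by a unitriangular factor. -/
theorem det_setIntegral_cell {p : ℕ} {u : Fin p → ℝ} (hu : StrictMono u) {w : ℝ → ℝ} {m : Fin p → ℕ}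
    (hint : ∀ j, Integrable fun y => w y * y ^ m j) :
    (of fun k j => ∫ y in cell u k, w y * y ^ m j).det
      = (of fun k j => tailMoment w (m j) (u k)).det := by
  -- multiplication by `D` from the left subtracts from each row its successor
  let D : Matrix (Fin p) (Fin p) ℝ :=
    of fun k i => if i = k then 1 else if (i : ℕ) = k + 1 then -1 else 0
  have hD : D.det = 1 := by
    rw [det_of_isUpperTriangular]
    · simp [D]
    · intro i j hij
      have hij : j < i := hij
      have h1 : j ≠ i := hij.ne
      have h2 : (j : ℕ) ≠ i + 1 := by have : (j : ℕ) < i := hij; omega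
      simp [D, h1, h2]
  have hmul : (of fun k j => ∫ y in cell u k, w y * y ^ m j)
      = D * (of fun k j => tailMoment w (m j) (u k)) := by
    ext k j
    rw [mul_apply, of_apply, setIntegral_cell hu k (hint j)]
    have : ∀ i : Fin p, D k i = (if i = k then 1 else 0) - if (i : ℕ) = k + 1 then 1 else 0 := by
      intro i
      by_cases h1 : i = k
      · have : ¬ (i : ℕ) = k + 1 := by rw [h1]; omega
        simp [D, h1]
      · by_cases h2 : (i : ℕ) = k + 1 <;> simp [D, h1, h2]
    simp_rw [this, sub_mul, Finset.sum_sub_distrib]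
    congr 1
    · simp
    · split_ifs with h
      · rw [Finset.sum_eq_single ⟨k + 1, h⟩]
        · simp
        · intro i _ hi
          rw [if_neg fun h' => hi (Fin.ext h'), zero_mul]
        · simp
      · symm
        refine Finset.sum_eq_zero fun i _ => ?_
        rw [if_neg (by have := i.2; omega), zero_mul]
  rw [hmul, det_mul, hD, one_mul]

theorem pos_of_mem_cell {p : ℕ} {u t : Fin p → ℝ} (hu0 : ∀ k, 0 ≤ u k)
    (ht : ∀ k, t k ∈ cell u k) (k : Fin p) : 0 < t k := (hu0 k).trans_lt (ht k).1

theorem strictMono_of_mem_cell {p : ℕ} {u t : Fin p → ℝ} (hu : Monotone u)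
    (ht : ∀ k, t k ∈ cell u k) : StrictMono t := by
  intro i j hij
  have h : (i : ℕ) + 1 < p := by have := j.2; have : (i : ℕ) < j := hij; omega
  have h2 : (⟨i + 1, h⟩ : Fin p) ≤ j := by
    have : (i : ℕ) < j := hij
    exact Fin.mk_le_of_le_val this
  exact (((ht i).2 h).trans_le (hu h2)).trans (ht j).1

/-- Integrating a determinant in independent rows over a product of cells gives the determinant of
the integrals. The integrand is nonnegative, as points of consecutive cells are increasing. -/
theorem setLIntegral_pi_cell {p : ℕ} {u : Fin p → ℝ} (hu : StrictMono u) (hu0 : ∀ k, 0 ≤ u k)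
    {w : ℝ → ℝ} (hnn : ∀ x, 0 ≤ w x) (c : ℕ)
    (hint : ∀ j : Fin p, Integrable fun y => w y * y ^ (2 * (j : ℕ) + c)) :
    ∫⁻ t in Set.univ.pi (cell u), ENNReal.ofReal ((∏ k, w (t k)) * (powerMatrix c t).det)
      = ENNReal.ofReal |(of fun k j : Fin p => tailMoment w (2 * (j : ℕ) + c) (u k)).det| := by
  have hmeas : MeasurableSet (Set.univ.pi (cell u)) :=
    MeasurableSet.univ_pi (measurableSet_cell u)
  have hdet : ∀ t : Fin p → ℝ, (∏ k, w (t k)) * (powerMatrix c t).det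
      = ∑ π : Equiv.Perm (Fin p), ((Equiv.Perm.sign π : ℤ) : ℝ) *
        ∏ k, (w (t k) * t k ^ (2 * (π k : ℕ) + c)) := by
    intro t
    rw [← det_transpose, det_apply', Finset.mul_sum]
    refine Finset.sum_congr rfl fun π _ => ?_
    simp only [transpose_apply, powerMatrix, of_apply, Finset.prod_mul_distrib]
    ring
  have hres : (volume : Measure (Fin p → ℝ)).restrict (Set.univ.pi (cell u))
      = Measure.pi fun k => volume.restrict (cell u k) := by
    rw [volume_pi, Measure.restrict_pi_pi]
  have hI : ∀ π : Equiv.Perm (Fin p), IntegrableOn (fun t : Fin p → ℝ =>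
      ((Equiv.Perm.sign π : ℤ) : ℝ) * ∏ k, (w (t k) * t k ^ (2 * (π k : ℕ) + c)))
      (Set.univ.pi (cell u)) := by
    intro π
    rw [IntegrableOn, hres]
    exact (Integrable.fintype_prod (f := fun k y => w y * y ^ (2 * (π k : ℕ) + c))
      fun k => (hint (π k)).integrableOn).const_mul _
  have hnonneg : ∀ t ∈ Set.univ.pi (cell u), 0 ≤ (∏ k, w (t k)) * (powerMatrix c t).det := by
    intro t ht
    have ht' : ∀ k, t k ∈ cell u k := fun k => ht k trivial
    exact mul_nonneg (Finset.prod_nonneg fun k _ => hnn _) (det_powerMatrix_nonneg c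
      (fun k => (pos_of_mem_cell hu0 ht' k).le) (strictMono_of_mem_cell hu.monotone ht').monotone)
  have hval : ∫ t in Set.univ.pi (cell u), (∏ k, w (t k)) * (powerMatrix c t).det
      = (of fun k j : Fin p => tailMoment w (2 * (j : ℕ) + c) (u k)).det := by
    rw [← det_setIntegral_cell hu hint, ← det_transpose, det_apply']
    simp_rw [hdet]
    rw [integral_finsetSum _ fun π _ => hI π]
    refine Finset.sum_congr rfl fun π _ => ?_
    rw [integral_const_mul, hres,
      integral_fintype_prod_eq_prod (f := fun k y => w y * y ^ (2 * (π k : ℕ) + c))]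
    rfl
  have hint' : IntegrableOn (fun t : Fin p → ℝ => (∏ k, w (t k)) * (powerMatrix c t).det)
      (Set.univ.pi (cell u)) := by
    simp_rw [hdet]
    exact integrable_finsetSum _ fun π _ => hI π
  rw [← ofReal_integral_eq_lintegral_ofReal hint'
    ((ae_restrict_iff' hmeas).2 (Filter.Eventually.of_forall hnonneg)), ← hval,
    abs_of_nonneg (setIntegral_nonneg hmeas hnonneg)]

/-- The lower ends of the cells that interlace with `s`: the tuple `s` itself for `r = 0`, and `s`
preceded by `0` for `r = 1`. -/
def lowerEnds {q p r : ℕ} (hp : p = q + r) (s : Fin q → ℝ) : Fin p → ℝ :=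
  fun k => if h : (k : ℕ) < r then 0 else s ⟨k - r, by omega⟩

/-- By `hrec`, subtracting a multiple of its predecessor from each column leaves `W(s_k) s_k ^ (2
j)` up to a factor `β`. -/
theorem det_tailMoment_even {q : ℕ} {w W : ℝ → ℝ} {α β : ℕ → ℝ}
    (h1 : 0 < q → ∀ u ≥ 0, tailMoment w 1 u = β 0 * W u)
    (hrec : ∀ k, k + 2 < 2 * q → ∀ u ≥ 0,
      tailMoment w (k + 2) u = α k * tailMoment w k u + β (k + 1) * (W u * u ^ (k + 1)))
    {s : Fin q → ℝ} (hs : ∀ j, 0 ≤ s j) :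
    (of fun k j : Fin q => tailMoment w (2 * (j : ℕ) + 1) (s k)).det
      = (∏ j : Fin q, β (2 * (j : ℕ))) * ((∏ j, W (s j)) * (powerMatrix 0 s).det) := by
  rw [← det_mul_column, ← det_mul_row]
  cases q with
  | zero => simp
  | succ q =>
    refine det_eq_of_forall_col_eq_smul_add_pred (fun j => α (2 * (j : ℕ) + 1)) ?_ ?_
    · intro i
      simpa [powerMatrix] using h1 (Nat.succ_pos q) (s i) (hs i)
    · intro i j
      have := hrec (2 * (j : ℕ) + 1) (by have := j.2; omega) (s i) (hs i)
      simp only [of_apply, powerMatrix, Fin.val_succ, Fin.val_castSucc]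
      rw [show 2 * ((j : ℕ) + 1) + 1 = 2 * (j : ℕ) + 1 + 2 by ring, this]
      rw [show 2 * ((j : ℕ) + 1) = 2 * (j : ℕ) + 1 + 1 by ring]
      ring_nf

/-- The column operations of `det_tailMoment_even`; here the row of the additional point `0` is
reduced to its first entry. -/
theorem det_tailMoment_odd {q : ℕ} {w W : ℝ → ℝ} {α β : ℕ → ℝ}
    (hrec : ∀ k, k + 2 < 2 * q + 1 → ∀ u ≥ 0,
      tailMoment w (k + 2) u = α k * tailMoment w k u + β (k + 1) * (W u * u ^ (k + 1)))
    {s : Fin q → ℝ} (hs : ∀ j, 0 ≤ s j) :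
    (of fun k j : Fin (q + 1) =>
        tailMoment w (2 * (j : ℕ)) ((Fin.cons 0 s : Fin (q + 1) → ℝ) k)).det
      = tailMoment w 0 0 * (∏ j : Fin q, β (2 * (j : ℕ) + 1)) *
        ((∏ j, W (s j)) * (powerMatrix 1 s).det) := by
  set u : Fin (q + 1) → ℝ := Fin.cons 0 s with hu
  have hu0 : ∀ k, 0 ≤ u k := by
    intro k
    refine Fin.cases ?_ (fun j => ?_) k <;> simp [hu, hs]
  let B : Matrix (Fin (q + 1)) (Fin (q + 1)) ℝ := of fun k => Fin.cons (tailMoment w 0 (u k))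
    fun j : Fin q => β (2 * (j : ℕ) + 1) * (W (u k) * u k ^ (2 * (j : ℕ) + 1))
  have hB : (of fun k j : Fin (q + 1) => tailMoment w (2 * (j : ℕ)) (u k)).det = B.det := by
    refine det_eq_of_forall_col_eq_smul_add_pred (fun j => α (2 * (j : ℕ))) ?_ ?_
    · intro i; simp [B]
    · intro i j
      have := hrec (2 * (j : ℕ)) (by have := j.2; omega) (u i) (hu0 i)
      simp only [of_apply, Fin.val_succ, Fin.val_castSucc, B, Fin.cons_succ]
      rw [show 2 * ((j : ℕ) + 1) = 2 * (j : ℕ) + 2 by ring, this]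
      ring
  have hB0 : ∀ j : Fin q, B 0 j.succ = 0 := by intro j; simp [B, hu]
  -- the first row of `B` belongs to the point `0`, where `W u * u ^ (2 * j + 1)` vanishes
  rw [hB, det_succ_row_zero, Fin.sum_univ_succ]
  simp only [hB0, mul_zero, zero_mul, Finset.sum_const_zero, add_zero, Fin.val_zero, pow_zero,
    one_mul]
  rw [mul_assoc, ← det_mul_column, ← det_mul_row]
  congr 2

theorem exists_abs_det_tailMoment {n q r p : ℕ} (hr : r < 2) (hp : p = q + r)
    (hn : 2 * q + r ≤ n + 1) {w W : ℝ → ℝ} {α β : ℕ → ℝ}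
    (h1 : 1 ≤ n → ∀ u ≥ 0, tailMoment w 1 u = β 0 * W u)
    (hrec : ∀ k, k + 2 ≤ n → ∀ u ≥ 0,
      tailMoment w (k + 2) u = α k * tailMoment w k u + β (k + 1) * (W u * u ^ (k + 1)))
    (hW : ∀ x > 0, 0 ≤ W x) :
    ∃ C : ℝ, 0 ≤ C ∧ ∀ s : Fin q → ℝ, (∀ j, 0 < s j) →
      |(of fun k j : Fin p => tailMoment w (2 * (j : ℕ) + (1 - r)) (lowerEnds hp s k)).det|
        = C * ((∏ j, W (s j)) * |(powerMatrix r s).det|) := by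
  have hWs : ∀ s : Fin q → ℝ, (∀ j, 0 < s j) → |∏ j, W (s j)| = ∏ j, W (s j) := fun s hs =>
    abs_of_nonneg (Finset.prod_nonneg fun j _ => hW _ (hs j))
  obtain rfl | rfl : r = 0 ∨ r = 1 := by omega
  · obtain rfl : p = q := hp
    refine ⟨|∏ j : Fin p, β (2 * (j : ℕ))|, abs_nonneg _, fun s hs => ?_⟩
    have := det_tailMoment_even (fun hq => h1 (by omega)) (fun k hk => hrec k (by omega))
      (fun j => (hs j).le)
    rw [← hWs s hs, ← abs_mul, ← abs_mul, ← this]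
    rfl
  · subst hp
    refine ⟨|tailMoment w 0 0 * ∏ j : Fin q, β (2 * (j : ℕ) + 1)|, abs_nonneg _, fun s hs => ?_⟩
    have := det_tailMoment_odd (q := q) (fun k hk => hrec k (by omega)) (fun j => (hs j).le)
    rw [← hWs s hs, ← abs_mul, ← abs_mul, ← this]
    congr 3
    ext k j
    refine Fin.cases ?_ (fun k => ?_) k <;> simp [lowerEnds]

end RandomEnsemble

/-! ### The even singular values of an orthogonal ensemble -/

namespace RandomEnsemble
open Matrix Finset

theorem abs_intUnits_cast (e : ℤˣ) : |((e : ℤ) : ℝ)| = 1 := by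
  rcases Int.units_eq_one_or e with h | h <;> simp [h]

theorem abs_det_vandermonde_comp_perm {n : ℕ} (x : Fin n → ℝ) (σ : Equiv.Perm (Fin n)) :
    |(vandermonde (x ∘ σ)).det| = |(vandermonde x).det| := by
  have : vandermonde (x ∘ σ) = (vandermonde x).submatrix σ id := rfl
  rw [this, det_permute, abs_mul, abs_intUnits_cast, one_mul]

theorem abs_det_powerMatrix_comp_perm {q : ℕ} (c : ℕ) (s : Fin q → ℝ) (σ : Equiv.Perm (Fin q)) :
    |(powerMatrix c (s ∘ σ)).det| = |(powerMatrix c s).det| := by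
  have : powerMatrix c (s ∘ σ) = (powerMatrix c s).submatrix σ id := rfl
  rw [this, det_permute, abs_mul, abs_intUnits_cast, one_mul]

/-- The sum over all signs is invariant under permutations, since a permutation of the entries may
be moved to the signs. -/
theorem sum_abs_det_vandermonde_signFlip_comp_perm {n : ℕ} (x : Fin n → ℝ)
    (σ : Equiv.Perm (Fin n)) :
    ∑ ε : Fin n → ℤˣ, |(vandermonde (signFlip ε (x ∘ σ))).det|
      = ∑ ε : Fin n → ℤˣ, |(vandermonde (signFlip ε x)).det| := by
  rw [← Equiv.sum_comp (Equiv.arrowCongr σ.symm (Equiv.refl ℤˣ))]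
  refine Finset.sum_congr rfl fun ε _ => ?_
  exact abs_det_vandermonde_comp_perm (signFlip ε x) σ

theorem parityDensity_comp_perm {q : ℕ} (w : ℝ → ℝ) (c : ℕ) (s : Fin q → ℝ)
    (σ : Equiv.Perm (Fin q)) : parityDensity w c (s ∘ σ) = parityDensity w c s := by
  by_cases hs : s ∈ positiveOrthant q
  · rw [parityDensity, parityDensity, Set.indicator_of_mem hs,
      Set.indicator_of_mem ((comp_perm_mem_positiveOrthant s σ).2 hs), prod_weight_perm,
      ← sq_abs, abs_det_powerMatrix_comp_perm, sq_abs]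
  · rw [parityDensity, parityDensity, Set.indicator_of_notMem hs,
      Set.indicator_of_notMem fun h => hs ((comp_perm_mem_positiveOrthant s σ).1 h)]

theorem lintegral_eq_card_mul_of_comp_perm {n : ℕ} {f : (Fin n → ℝ) → ENNReal} (hf : Measurable f)
    (hperm : ∀ (x : Fin n → ℝ) (σ : Equiv.Perm (Fin n)), f (x ∘ σ) = f x) :
    ∫⁻ x, f x = Fintype.card (Equiv.Perm (Fin n)) * ∫⁻ x in {x | StrictMono x}, f x := by
  rw [lintegral_eq_strictMono hf, ← lintegral_const_mul _ hf]
  simp only [hperm, Finset.sum_const, Finset.card_univ, nsmul_eq_mul]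

theorem lowerEnds_nonneg {q r p : ℕ} (hp : p = q + r) {s : Fin q → ℝ}
    (hpos : ∀ j, 0 < s j) (k : Fin p) : 0 ≤ lowerEnds hp s k := by
  rw [lowerEnds]
  split_ifs
  · exact le_rfl
  · exact (hpos _).le

/-- A tuple is positive and increasing if and only if one parity class of its entries is, and the
other class interlaces with it. -/
theorem join_mem_chamber_iff {q r p N : ℕ} (hr : r < 2) (hp : p = q + r) (hN : N = 2 * q + r)
    (s : Fin q → ℝ) (t : Fin p → ℝ) :
    (join (paritySplit hr hp hN) s t ∈ positiveOrthant N ∧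
        StrictMono (join (paritySplit hr hp hN) s t))
      ↔ (s ∈ positiveOrthant q ∧ StrictMono s) ∧ t ∈ Set.univ.pi (cell (lowerEnds hp s)) := by
  set e := paritySplit hr hp hN with he
  set x := join e s t with hx
  have hxs : ∀ (j : Fin q) (h : 2 * (j : ℕ) + r < N), x ⟨2 * j + r, h⟩ = s j := by
    intro j h
    exact join_inl e s t j
  have hxt : ∀ (k : Fin p) (h : 2 * (k : ℕ) + 1 - r < N), x ⟨2 * k + 1 - r, h⟩ = t k := by
    intro k h
    exact join_inr e s t k
  constructor
  · rintro ⟨hpos, hmono⟩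
    refine ⟨⟨fun j => ?_, fun i j hij => ?_⟩, fun k _ => ⟨?_, fun h => ?_⟩⟩
    · rw [← hxs j (by omega)]; exact hpos _
    · rw [← hxs i (by omega), ← hxs j (by omega)]
      refine hmono (Fin.mk_lt_mk.2 ?_)
      have : (i : ℕ) < j := hij
      omega
    · rw [← hxt k (by omega), lowerEnds]
      split_ifs with h
      · exact hpos _
      · rw [← hxs _ (by simp only; omega)]
        exact hmono (Fin.mk_lt_mk.2 (by simp only; omega))
    · rw [← hxt k (by omega), lowerEnds, dif_neg (by simp only; omega),
        ← hxs _ (by simp only; omega)]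
      exact hmono (Fin.mk_lt_mk.2 (by simp only; omega))
  · rintro ⟨⟨hpos, hmono⟩, ht⟩
    have ht1 : ∀ k, lowerEnds hp s k < t k := fun k => (ht k trivial).1
    have ht2 : ∀ (k : Fin p) (h : (k : ℕ) + 1 < p), t k < lowerEnds hp s ⟨k + 1, h⟩ :=
      fun k => (ht k trivial).2
    refine ⟨?_, ?_⟩
    · intro i
      obtain ⟨j | k, rfl⟩ := e.surjective i
      · rw [hx, join_inl]; exact hpos j
      · rw [hx, join_inr]; exact (lowerEnds_nonneg hp hpos k).trans_lt (ht1 k)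
    · cases N with
      | zero => exact fun i => i.elim0
      | succ N =>
        refine Fin.strictMono_iff_lt_succ.2 fun i => ?_
        -- consecutive entries belong to different classes
        by_cases hi : (i : ℕ) % 2 = r
        · have h1 : i.castSucc = ⟨2 * ((⟨i / 2, by omega⟩ : Fin q) : ℕ) + r, by simp only; omega⟩ :=
            Fin.ext (by simp only [Fin.val_castSucc]; omega)
          have h2 : i.succ = ⟨2 * ((⟨i / 2 + r, by omega⟩ : Fin p) : ℕ) + 1 - r,
              by simp only; omega⟩ := Fin.ext (by simp only [Fin.val_succ]; omega)
          rw [h1, h2, hxs, hxt]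
          refine lt_of_eq_of_lt ?_ (ht1 _)
          rw [lowerEnds, dif_neg (by simp only; omega)]
          congr 1
          exact Fin.ext (by show (i : ℕ) / 2 = (i : ℕ) / 2 + r - r; omega)
        · have h1 : i.castSucc = ⟨2 * ((⟨i / 2, by omega⟩ : Fin p) : ℕ) + 1 - r,
              by simp only; omega⟩ := Fin.ext (by simp only [Fin.val_castSucc]; omega)
          have h2 : i.succ = ⟨2 * ((⟨i / 2 + 1 - r, by omega⟩ : Fin q) : ℕ) + r,
              by simp only; omega⟩ := Fin.ext (by simp only [Fin.val_succ]; omega)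
          rw [h1, h2, hxs, hxt]
          refine lt_of_lt_of_eq (ht2 _ (by show (i : ℕ) / 2 + 1 < p; omega)) ?_
          rw [lowerEnds, dif_neg (by simp only; omega)]

theorem strictMono_lowerEnds {q r p : ℕ} (hr : r < 2) (hp : p = q + r) {s : Fin q → ℝ}
    (hpos : ∀ j, 0 < s j) (hmono : StrictMono s) : StrictMono (lowerEnds hp s) := by
  intro i j hij
  have hij' : (i : ℕ) < j := hij
  rw [lowerEnds, lowerEnds, dif_neg (by omega : ¬ (j : ℕ) < r)]
  split_ifs with h
  · exact hpos _
  · exact hmono (Fin.mk_lt_mk.2 (by omega))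

/-- The 2nd, 4th, … largest entry of an increasing tuple are those of the first parity class. -/
theorem even_decreasing_join {N p : ℕ} (hr : N % 2 < 2) (hp : p = N / 2 + N % 2)
    (hN : N = 2 * (N / 2) + N % 2) {s : Fin (N / 2) → ℝ} {t : Fin p → ℝ} (hs : StrictMono s)
    (hmono : StrictMono (join (paritySplit hr hp hN) s t)) :
    even (decreasing (join (paritySplit hr hp hN) s t)) = decreasing s := by
  rw [decreasing_of_monotone hmono.monotone, decreasing_of_monotone hs.monotone]
  funext j
  rw [even, ← join_inl (paritySplit hr hp hN) s t j.rev]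
  congr 1
  refine Fin.ext ?_
  rw [paritySplit_inl, Fin.val_rev, Fin.val_rev]
  simp only
  omega

/-- What the proof requires of a pair of weights `w₁`, `w₂` for the orthogonal ensembles of the
orders `n` and `n + 1` and the unitary ensemble of order `n`: positivity, symmetry, the moments
that make the densities integrable, and the recurrence of the tail moments of `w₁`, which is the
integrated form of the Pearson equation. Here `w₂ = w₁ W` on the positive half-line. The constants
`α`, `β` may be arbitrary. -/
structure IsPearsonPair (n : ℕ) (w₁ w₂ W : ℝ → ℝ) (α β : ℕ → ℝ) : Prop where
  measurable_left : Measurable w₁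
  measurable_right : Measurable w₂
  nonneg_left : ∀ x, 0 ≤ w₁ x
  nonneg_right : ∀ x, 0 ≤ w₂ x
  even_left : ∀ x, w₁ (-x) = w₁ x
  even_right : ∀ x, w₂ (-x) = w₂ x
  pos_left : ∀ x ∈ Set.Ioo (0 : ℝ) 1, 0 < w₁ x
  pos_right : ∀ x ∈ Set.Ioo (0 : ℝ) 1, 0 < w₂ x
  integrable_left : ∀ k ≤ n, Integrable fun x => w₁ x * x ^ k
  integrable_right : ∀ k, k + 2 ≤ 2 * n → Integrable fun x => w₂ x * x ^ k
  nonneg_factor : ∀ x > 0, 0 ≤ W x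
  mul_factor : ∀ x > 0, w₁ x * W x = w₂ x
  tailMoment_one : 1 ≤ n → ∀ u ≥ 0, tailMoment w₁ 1 u = β 0 * W u
  tailMoment_add_two : ∀ k, k + 2 ≤ n → ∀ u ≥ 0,
    tailMoment w₁ (k + 2) u = α k * tailMoment w₁ k u + β (k + 1) * (W u * u ^ (k + 1))

/-- The even singular values of the orthogonal ensemble of order `N` follow, up to normalization,
the density `parityDensity w₂ (N % 2)`. -/
theorem IsPearsonPair.exists_lintegral_orthogonal {n N : ℕ} {w₁ w₂ W : ℝ → ℝ} {α β : ℕ → ℝ}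
    (hw : IsPearsonPair n w₁ w₂ W α β) (hNn : N ≤ n + 1) :
    ∃ C : ENNReal, ∀ G : (Fin (N / 2) → ℝ) → ENNReal, Measurable G →
      ∫⁻ x, G (even (singularValues x)) ∂(weightedMeasure 1 w₁ N)
        = C * ∫⁻ s : Fin (N / 2) → ℝ, G (decreasing s) * parityDensity w₂ (N % 2) s := by
  have hr : N % 2 < 2 := by omega
  have hp : (N + 1) / 2 = N / 2 + N % 2 := by omega
  have hN : N = 2 * (N / 2) + N % 2 := by omega
  set q := N / 2 with hq
  set r := N % 2 with hrdef
  set p := (N + 1) / 2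
  obtain ⟨C, hC0, hC⟩ := exists_abs_det_tailMoment (n := n) hr hp (by omega)
    hw.tailMoment_one hw.tailMoment_add_two hw.nonneg_factor
  refine ⟨Fintype.card (Equiv.Perm (Fin N)) * ENNReal.ofReal (2 ^ N * C) *
    (Fintype.card (Equiv.Perm (Fin q)) : ENNReal)⁻¹, fun G hG => ?_⟩
  have hGd : Measurable fun s : Fin q → ℝ => G (decreasing s) * parityDensity w₂ r s :=
    (hG.comp measurable_decreasing).mul (measurable_parityDensity hw.measurable_right r)
  -- the right-hand side, reduced to increasing tuples
  rw [lintegral_eq_card_mul_of_comp_perm hGd fun s σ => by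
    rw [decreasing_comp_perm, parityDensity_comp_perm]]
  rw [mul_assoc, ← mul_assoc _ (Fintype.card (Equiv.Perm (Fin q)) : ENNReal),
    ENNReal.inv_mul_cancel (Nat.cast_ne_zero.2 Fintype.card_ne_zero) (ENNReal.natCast_ne_top _),
    one_mul]
  -- the left-hand side, reduced to the chamber
  let h : (Fin N → ℝ) → ENNReal := fun x => (positiveOrthant N).indicator (fun x =>
    G (even (decreasing x)) * ENNReal.ofReal ((∏ k, w₁ (x k)) *
      ∑ ε : Fin N → ℤˣ, |(vandermonde (signFlip ε x)).det|)) x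
  have hflip : Measurable fun x : Fin N → ℝ =>
      ∑ ε : Fin N → ℤˣ, |(vandermonde (signFlip ε x)).det| :=
    Finset.measurable_fun_sum _ fun ε _ => measurable_norm.comp
      (continuous_det_vandermonde.measurable.comp (measurePreserving_signFlip ε).measurable)
  have hh : Measurable h := Measurable.indicator
    ((hG.comp (measurable_even.comp measurable_decreasing)).mul
    ((measurable_prod_weight hw.measurable_left).mul hflip).ennreal_ofReal)
    (measurableSet_positiveOrthant N)
  have hperm : ∀ (x : Fin N → ℝ) (σ : Equiv.Perm (Fin N)), h (x ∘ σ) = h x := by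
    intro x σ
    by_cases hx : x ∈ positiveOrthant N
    · simp only [h, Set.indicator_of_mem hx,
        Set.indicator_of_mem ((comp_perm_mem_positiveOrthant x σ).2 hx), decreasing_comp_perm,
        prod_weight_perm, sum_abs_det_vandermonde_signFlip_comp_perm]
    · simp only [h, Set.indicator_of_notMem hx,
        Set.indicator_of_notMem fun h' => hx ((comp_perm_mem_positiveOrthant x σ).1 h')]
  have hL : ∫⁻ x, G (even (singularValues x)) ∂(weightedMeasure 1 w₁ N)
      = Fintype.card (Equiv.Perm (Fin N)) * ∫⁻ x, {x | StrictMono x}.indicator h x := by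
    rw [lintegral_singularValues_weightedMeasure 1 hw.measurable_left hw.nonneg_left hw.even_left
      (F := fun y => G (even y))
      (hG.comp measurable_even)]
    simp only [pow_one]
    rw [← lintegral_indicator (measurableSet_positiveOrthant N),
      lintegral_indicator (measurableSet_strictMono N)]
    exact lintegral_eq_card_mul_of_comp_perm hh hperm
  rw [hL, mul_assoc]
  congr 1
  rw [lintegral_join (paritySplit hr hp hN) (hh.indicator (measurableSet_strictMono N)),
    ← lintegral_indicator (measurableSet_strictMono q), ← lintegral_const_mul' _ _
    ENNReal.ofReal_ne_top]
  refine lintegral_congr fun s => ?_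
  by_cases hs : s ∈ positiveOrthant q ∧ StrictMono s
  · have hpt : ∀ t : Fin p → ℝ,
        {x | StrictMono x}.indicator h (join (paritySplit hr hp hN) s t)
          = G (decreasing s) * ENNReal.ofReal (2 ^ N * ((∏ j, w₁ (s j)) * (powerMatrix r s).det)) *
            (Set.univ.pi (cell (lowerEnds hp s))).indicator (fun t =>
              ENNReal.ofReal ((∏ k, w₁ (t k)) * (powerMatrix (1 - r) t).det)) t := by
      intro t
      by_cases ht : t ∈ Set.univ.pi (cell (lowerEnds hp s))
      · obtain ⟨hx, hm⟩ := (join_mem_chamber_iff hr hp hN s t).2 ⟨hs, ht⟩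
        rw [Set.indicator_of_mem (show _ ∈ {x | StrictMono x} from hm), Set.indicator_of_mem ht]
        simp only [h]
        rw [Set.indicator_of_mem hx, even_decreasing_join hr hp hN hs.2 hm,
          sum_abs_det_vandermonde_signFlip hx hm, mul_assoc, ← ENNReal.ofReal_mul
          (mul_nonneg (by positivity) (mul_nonneg (Finset.prod_nonneg fun _ _ => hw.nonneg_left _)
            (det_powerMatrix_nonneg r (fun j => (hs.1 j).le) hs.2.monotone))),
          det_checkerboard hr hp hN, ← (paritySplit hr hp hN).prod_comp, Fintype.prod_sum_type]
        simp only [join_inl, join_inr]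
        congr 2
        ring
      · rw [Set.indicator_of_notMem ht, mul_zero]
        by_cases hm : StrictMono (join (paritySplit hr hp hN) s t)
        · rw [Set.indicator_of_mem (show _ ∈ {x | StrictMono x} from hm)]
          exact Set.indicator_of_notMem
            (fun hx => ht ((join_mem_chamber_iff hr hp hN s t).1 ⟨hx, hm⟩).2) _
        · exact Set.indicator_of_notMem hm _
    have hmeas : MeasurableSet (Set.univ.pi (cell (lowerEnds hp s))) :=
      MeasurableSet.univ_pi (measurableSet_cell _)
    have hdet0 := det_powerMatrix_nonneg r (fun j => (hs.1 j).le) hs.2.monotone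
    have hprod0 : 0 ≤ ∏ j, w₁ (s j) := Finset.prod_nonneg fun _ _ => hw.nonneg_left _
    have hmeas' : Measurable ((Set.univ.pi (cell (lowerEnds hp s))).indicator fun t =>
        ENNReal.ofReal ((∏ k, w₁ (t k)) * (powerMatrix (1 - r) t).det)) :=
      Measurable.indicator ((measurable_prod_weight hw.measurable_left).mul
        (continuous_det_powerMatrix _).measurable).ennreal_ofReal hmeas
    simp_rw [hpt]
    rw [lintegral_const_mul _ hmeas',
      lintegral_indicator hmeas, setLIntegral_pi_cell (strictMono_lowerEnds hr hp hs.1 hs.2)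
        (lowerEnds_nonneg hp hs.1) hw.nonneg_left (1 - r) fun j => hw.integrable_left _ (by omega),
      hC s hs.1, Set.indicator_of_mem (show s ∈ {x | StrictMono x} from hs.2), parityDensity,
      Set.indicator_of_mem hs.1, mul_left_comm (ENNReal.ofReal (2 ^ N * C)),
      mul_assoc (G (decreasing s)), ← ENNReal.ofReal_mul (by positivity),
      ← ENNReal.ofReal_mul (by positivity), abs_of_nonneg hdet0]
    congr 2
    rw [← Finset.prod_congr rfl fun j _ => hw.mul_factor (s j) (hs.1 j), Finset.prod_mul_distrib]
    ring
  · have hz : ∀ t : Fin p → ℝ,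
        {x | StrictMono x}.indicator h (join (paritySplit hr hp hN) s t) = 0 := by
      intro t
      by_cases hm : StrictMono (join (paritySplit hr hp hN) s t)
      · rw [Set.indicator_of_mem (show _ ∈ {x | StrictMono x} from hm)]
        exact Set.indicator_of_notMem
          (fun hx => hs ((join_mem_chamber_iff hr hp hN s t).1 ⟨hx, hm⟩).1) _
      · exact Set.indicator_of_notMem hm _
    simp only [hz, lintegral_zero]
    symm
    by_cases hm : StrictMono s
    · rw [Set.indicator_of_mem (show s ∈ {x | StrictMono x} from hm), parityDensity,
        Set.indicator_of_notMem fun h' => hs ⟨h', hm⟩]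
      simp
    · rw [Set.indicator_of_notMem hm, mul_zero]

end RandomEnsemble

/-! ### Equality of the two laws -/

namespace RandomEnsemble

theorem IsPearsonPair.isProbabilityMeasure_unitary {n : ℕ} {w₁ w₂ W : ℝ → ℝ} {α β : ℕ → ℝ}
    (hw : IsPearsonPair n w₁ w₂ W α β) : IsProbabilityMeasure (UE n w₂) :=
  isProbabilityMeasure_eigenvalueLaw hw.measurable_right hw.pos_right
    (integrable_eigenvalueDensity_two hw.integrable_right)

theorem IsPearsonPair.isProbabilityMeasure_orthogonal {n N : ℕ} {w₁ w₂ W : ℝ → ℝ} {α β : ℕ → ℝ}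
    (hw : IsPearsonPair n w₁ w₂ W α β) (hN : N ≤ n + 1) : IsProbabilityMeasure (OE N w₁) :=
  isProbabilityMeasure_eigenvalueLaw hw.measurable_left hw.pos_left
    (integrable_eigenvalueDensity_one hw.nonneg_left fun k hk => hw.integrable_left k (by omega))

/-- Fubini's theorem for two independent random variables `φ`, `ψ` whose laws are given by
densities `f`, `g` up to constants, after the reorderings `γ`, `δ`. -/
theorem lintegral_prod_of_lintegral_eq {Ω Ω' X Y : Type*} [MeasurableSpace Ω]
    [MeasurableSpace Ω'] [MeasurableSpace X] [MeasurableSpace Y] {μ : Measure Ω} {ν : Measure Ω'}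
    [SFinite ν] {ρ : Measure X} {κ : Measure Y} [SFinite κ]
    {φ : Ω → X} {ψ : Ω' → Y} (hφ : Measurable φ) (hψ : Measurable ψ)
    {γ : X → X} {δ : Y → Y} (hγ : Measurable γ) (hδ : Measurable δ)
    {f : X → ENNReal} {g : Y → ENNReal} (hf : Measurable f) (hg : Measurable g) {C D : ENNReal}
    (hμ : ∀ G : X → ENNReal, Measurable G → ∫⁻ x, G (φ x) ∂μ = C * ∫⁻ s, G (γ s) * f s ∂ρ)
    (hν : ∀ G : Y → ENNReal, Measurable G → ∫⁻ y, G (ψ y) ∂ν = D * ∫⁻ t, G (δ t) * g t ∂κ)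
    {F : X × Y → ENNReal} (hF : Measurable F) :
    ∫⁻ p, F (φ p.1, ψ p.2) ∂(μ.prod ν)
      = C * D * ∫⁻ s, ∫⁻ t, F (γ s, δ t) * (f s * g t) ∂κ ∂ρ := by
  have hR : Measurable fun p : Ω × Ω' => F (φ p.1, ψ p.2) :=
    hF.comp ((hφ.comp measurable_fst).prodMk (hψ.comp measurable_snd))
  have hinner : ∀ s : X, ∫⁻ y, F (s, ψ y) ∂ν = D * ∫⁻ t, F (s, δ t) * g t ∂κ := fun s =>
    hν (fun t => F (s, t)) (hF.comp measurable_prodMk_left)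
  have hG : Measurable fun s : X => ∫⁻ t, F (s, δ t) * g t ∂κ := by
    refine Measurable.lintegral_prod_right' (f := fun z : X × Y => F (z.1, δ z.2) * g z.2) ?_
    exact (hF.comp (measurable_fst.prodMk (hδ.comp measurable_snd))).mul (hg.comp measurable_snd)
  rw [lintegral_prod _ hR.aemeasurable]
  simp only [hinner]
  rw [hμ (fun s => D * ∫⁻ t, F (s, δ t) * g t ∂κ) (hG.const_mul D), mul_assoc]
  congr 1
  have hGd : Measurable fun s : X => (∫⁻ t, F (γ s, δ t) * g t ∂κ) * f s := (hG.comp hγ).mul hf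
  simp only [mul_assoc D]
  rw [lintegral_const_mul _ hGd]
  congr 1
  refine lintegral_congr fun s => ?_
  have hFt : Measurable fun t : Y => F (γ s, δ t) * g t :=
    (hF.comp (measurable_const.prodMk hδ)).mul hg
  rw [← lintegral_mul_const _ hFt]
  refine lintegral_congr fun t => ?_
  rw [mul_assoc, mul_comm (g t)]

theorem lintegral_eigenvalueLaw {n β : ℕ} {w : ℝ → ℝ} (f : (Fin n → ℝ) → ENNReal) :
    ∫⁻ x, f x ∂(eigenvalueLaw β w n)
      = (weightedMeasure β w n Set.univ)⁻¹ * ∫⁻ x, f x ∂(weightedMeasure β w n) := by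
  rw [eigenvalueLaw, lintegral_smul_measure, smul_eq_mul]

/-- Two probability measures that are constant multiples of the same functional coincide, as both
constants are `(J 1)⁻¹`. -/
theorem eq_of_lintegral_eq_const_mul {α : Type*} [MeasurableSpace α] {μ ν : Measure α}
    [IsProbabilityMeasure μ] [IsProbabilityMeasure ν] {J : (α → ENNReal) → ENNReal} {a b : ENNReal}
    (ha : ∀ F : α → ENNReal, Measurable F → ∫⁻ y, F y ∂μ = a * J F)
    (hb : ∀ F : α → ENNReal, Measurable F → ∫⁻ y, F y ∂ν = b * J F) : μ = ν := by
  have ha1 := ha (fun _ => 1) measurable_const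
  have hb1 := hb (fun _ => 1) measurable_const
  rw [lintegral_one, measure_univ] at ha1 hb1
  have hab : a = b := (ENNReal.eq_inv_of_mul_eq_one_left ha1.symm).trans
    (ENNReal.eq_inv_of_mul_eq_one_left hb1.symm).symm
  refine Measure.ext_of_lintegral _ fun F hF => ?_
  rw [ha F hF, hb F hF, hab]

theorem measurable_even_singularValues (N : ℕ) :
    Measurable fun x : Fin N → ℝ => even (singularValues x) :=
  measurable_even.comp measurable_singularValues

theorem IsPearsonPair.exists_lintegral_prod {n : ℕ} {w₁ w₂ W : ℝ → ℝ} {α β : ℕ → ℝ}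
    (hw : IsPearsonPair n w₁ w₂ W α β) :
    ∃ B : ENNReal, ∀ F : (Fin n → ℝ) → ENNReal, Measurable F →
      ∫⁻ p, F (superpose (half_add_half n) (even (singularValues p.1))
          (even (singularValues p.2))) ∂((OE n w₁).prod (OE (n + 1) w₁))
        = B * ∫⁻ s : Fin (n / 2) → ℝ, ∫⁻ t : Fin ((n + 1) / 2) → ℝ,
          F (superpose (half_add_half n) (decreasing s) (decreasing t)) *
            (parityDensity w₂ (n % 2) s * parityDensity w₂ ((n + 1) % 2) t) := by
  have := hw.isProbabilityMeasure_orthogonal (le_refl (n + 1))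
  have hlaw : ∀ N ≤ n + 1, ∃ C : ENNReal, ∀ G : (Fin (N / 2) → ℝ) → ENNReal, Measurable G →
      ∫⁻ x, G (even (singularValues x)) ∂(OE N w₁)
        = C * ∫⁻ s : Fin (N / 2) → ℝ, G (decreasing s) * parityDensity w₂ (N % 2) s := by
    intro N hN
    obtain ⟨C, hC⟩ := hw.exists_lintegral_orthogonal hN
    exact ⟨_, fun G hG => by rw [OE, lintegral_eigenvalueLaw, hC G hG, ← mul_assoc]⟩
  obtain ⟨C, hC⟩ := hlaw n (Nat.le_succ n)
  obtain ⟨D, hD⟩ := hlaw (n + 1) le_rfl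
  refine ⟨C * D, fun F hF => ?_⟩
  have hF' : Measurable fun z : (Fin (n / 2) → ℝ) × (Fin ((n + 1) / 2) → ℝ) =>
      F (superpose (half_add_half n) z.1 z.2) := hF.comp (measurable_superpose (half_add_half n))
  have key := lintegral_prod_of_lintegral_eq (μ := OE n w₁) (ν := OE (n + 1) w₁)
    (ρ := volume) (κ := volume)
    (measurable_even_singularValues n) (measurable_even_singularValues (n + 1))
    measurable_decreasing measurable_decreasing
    (measurable_parityDensity hw.measurable_right (n % 2))
    (measurable_parityDensity hw.measurable_right ((n + 1) % 2)) hC hD hF'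
  exact key

theorem IsPearsonPair.identDistrib {n : ℕ} {w₁ w₂ W : ℝ → ℝ} {α β : ℕ → ℝ}
    (hw : IsPearsonPair n w₁ w₂ W α β) :
    IdentDistrib
      (fun x : Fin n → ℝ => singularValues x)
      (fun p : (Fin n → ℝ) × (Fin (n + 1) → ℝ) =>
        superpose (half_add_half n) (even (singularValues p.1)) (even (singularValues p.2)))
      (UE n w₂) ((OE n w₁).prod (OE (n + 1) w₁)) := by
  have := hw.isProbabilityMeasure_unitary
  have := hw.isProbabilityMeasure_orthogonal (Nat.le_succ n)
  have := hw.isProbabilityMeasure_orthogonal (le_refl (n + 1))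
  have hR : Measurable fun p : (Fin n → ℝ) × (Fin (n + 1) → ℝ) =>
      superpose (half_add_half n) (even (singularValues p.1)) (even (singularValues p.2)) := by
    have h1 : Measurable fun p : (Fin n → ℝ) × (Fin (n + 1) → ℝ) => even (singularValues p.1) :=
      (measurable_even_singularValues n).comp measurable_fst
    have h2 : Measurable fun p : (Fin n → ℝ) × (Fin (n + 1) → ℝ) => even (singularValues p.2) :=
      (measurable_even_singularValues (n + 1)).comp measurable_snd
    have := (measurable_superpose (half_add_half n)).comp (h1.prodMk h2)
    exact this
  refine ⟨measurable_singularValues.aemeasurable, hR.aemeasurable, ?_⟩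
  obtain ⟨A, hA⟩ := exists_lintegral_unitary (n := n) hw.measurable_right hw.nonneg_right
    hw.even_right
  obtain ⟨B, hB⟩ := hw.exists_lintegral_prod
  have := Measure.isProbabilityMeasure_map (μ := UE n w₂) (measurable_singularValues).aemeasurable
  have := Measure.isProbabilityMeasure_map (μ := (OE n w₁).prod (OE (n + 1) w₁)) hR.aemeasurable
  refine eq_of_lintegral_eq_const_mul (J := fun F =>
    ∫⁻ s : Fin (n / 2) → ℝ, ∫⁻ t : Fin ((n + 1) / 2) → ℝ,
      F (superpose (half_add_half n) (decreasing s) (decreasing t)) *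
        (parityDensity w₂ (n % 2) s * parityDensity w₂ ((n + 1) % 2) t))
    (a := (weightedMeasure 2 w₂ n Set.univ)⁻¹ * A) (b := B)
    (fun F hF => ?_) (fun F hF => ?_)
  · rw [lintegral_map hF measurable_singularValues, UE, lintegral_eigenvalueLaw, hA F hF, mul_assoc]
  · rw [lintegral_map hF hR, hB F hF]

end RandomEnsemble

/-! ### The Gauss, symmetric Jacobi and Cauchy weights -/

namespace RandomEnsemble
open Set Filter Topology

/-- The recurrence of the tail moments, solved for the highest one. -/
theorem tailMoment_of_pearson {n : ℕ} {w W : ℝ → ℝ} {c d : ℝ}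
    (hint : ∀ k ≤ n, Integrable fun x => w x * x ^ k)
    (hne : ∀ m : ℕ, m + 1 ≤ n → c + m * d ≠ 0)
    (h : ∀ m : ℕ, m + 1 ≤ n → ∀ u ≥ 0,
      ∫ x in Ioi u, w x * (m * x ^ (m - 1) + (c + m * d) * x ^ (m + 1)) = -(W u * u ^ m)) :
    (1 ≤ n → ∀ u ≥ 0, tailMoment w 1 u = -(c + (0 : ℕ) * d)⁻¹ * W u) ∧
    ∀ k, k + 2 ≤ n → ∀ u ≥ 0, tailMoment w (k + 2) u
      = -((k + 1 : ℕ) / (c + (k + 1 : ℕ) * d)) * tailMoment w k u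
        + -(c + (k + 1 : ℕ) * d)⁻¹ * (W u * u ^ (k + 1)) := by
  constructor
  · intro hn u hu
    have h0 := h 0 (by omega) u hu
    have hc := hne 0 (by omega)
    have : ∀ x, w x * (((0 : ℕ) : ℝ) * x ^ (0 - 1) + (c + (0 : ℕ) * d) * x ^ (0 + 1))
        = (c + (0 : ℕ) * d) * (w x * x ^ 1) := fun x => by push_cast; ring
    simp_rw [this] at h0
    rw [integral_const_mul, pow_zero, mul_one] at h0
    refine mul_left_cancel₀ hc ?_
    rw [tailMoment, h0]
    field_simp
  · intro k hk u hu
    have h0 := h (k + 1) (by omega) u hu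
    have hc := hne (k + 1) (by omega)
    have : ∀ x, w x *
        (((k + 1 : ℕ) : ℝ) * x ^ (k + 1 - 1) + (c + (k + 1 : ℕ) * d) * x ^ (k + 1 + 1))
        = ((k + 1 : ℕ) : ℝ) * (w x * x ^ k) + (c + (k + 1 : ℕ) * d) * (w x * x ^ (k + 2)) :=
      fun x => by rw [Nat.add_sub_cancel]; ring
    simp_rw [this] at h0
    rw [integral_add ((hint k (by omega)).const_mul _).integrableOn
      ((hint (k + 2) hk).const_mul _).integrableOn, integral_const_mul, integral_const_mul] at h0
    rw [tailMoment, tailMoment]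
    field_simp
    linarith

/-- If `W = w · (1 + d x²)` and `W' = c x w`, then the derivative of `W x ^ m` is `w` times a
polynomial with two terms. -/
theorem hasDerivAt_mul_pow_of_pearson {w W : ℝ → ℝ} {c d x : ℝ} (m : ℕ)
    (hW : W x = w x * (1 + d * x ^ 2)) (hd : HasDerivAt W (c * x * w x) x) :
    HasDerivAt (fun x => W x * x ^ m) (w x * (m * x ^ (m - 1) + (c + m * d) * x ^ (m + 1))) x := by
  refine (hd.mul (hasDerivAt_pow m x)).congr_deriv ?_
  rw [hW]
  cases m with
  | zero => simp; ring
  | succ m => simp only [Nat.add_sub_cancel]; push_cast; ring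

theorem integrable_mul_pearson {n : ℕ} {w : ℝ → ℝ} (hint : ∀ k ≤ n, Integrable fun x => w x * x ^ k)
    {m : ℕ} (hm : m + 1 ≤ n) (A B : ℝ) :
    Integrable fun x => w x * (A * x ^ (m - 1) + B * x ^ (m + 1)) := by
  refine (((hint (m - 1) (by omega)).const_mul A).add ((hint (m + 1) hm).const_mul B)).congr
    (Eventually.of_forall fun x => ?_)
  simp only [Pi.add_apply]
  ring

/-- The Pearson equation on the whole line, integrated from `u` to `∞`. -/
theorem integral_Ioi_of_pearson {n : ℕ} {w W : ℝ → ℝ} {c d : ℝ}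
    (hint : ∀ k ≤ n, Integrable fun x => w x * x ^ k)
    (hW : ∀ x, W x = w x * (1 + d * x ^ 2)) (hd : ∀ x, HasDerivAt W (c * x * w x) x)
    (hlim : ∀ m : ℕ, m + 1 ≤ n → Tendsto (fun x => W x * x ^ m) atTop (𝓝 0))
    (m : ℕ) (hm : m + 1 ≤ n) (u : ℝ) :
    ∫ x in Ioi u, w x * (m * x ^ (m - 1) + (c + m * d) * x ^ (m + 1)) = -(W u * u ^ m) := by
  rw [integral_Ioi_of_hasDerivAt_of_tendsto'
    (fun x _ => hasDerivAt_mul_pow_of_pearson m (hW x) (hd x))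
    (integrable_mul_pearson hint hm _ _).integrableOn (hlim m hm), zero_sub]

theorem integrable_gaussWeight_mul_pow {b : ℝ} (hb : 0 < b) (k : ℕ) :
    Integrable fun x => gaussWeight b x * x ^ k := by
  have h := integrable_rpow_mul_exp_neg_mul_sq hb (s := k)
    (by have := Nat.cast_nonneg (α := ℝ) k; linarith)
  refine h.congr (Eventually.of_forall fun x => ?_)
  simp only [Real.rpow_natCast, gaussWeight]
  rw [neg_mul, mul_comm]

theorem exists_isPearsonPair_gauss (n : ℕ) :
    ∃ W α β, IsPearsonPair n (gaussWeight (1 / 2)) (gaussWeight 1) W α β := by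
  have hint : ∀ k ≤ n, Integrable fun x => gaussWeight (1 / 2) x * x ^ k := fun k _ =>
    integrable_gaussWeight_mul_pow (by norm_num) k
  have hd : ∀ x, HasDerivAt (gaussWeight (1 / 2)) (-1 * x * gaussWeight (1 / 2) x) x := by
    intro x
    have h : HasDerivAt (fun y : ℝ => -(1 / 2 * y ^ 2)) (-(1 / 2 * ((2 : ℕ) * x ^ (2 - 1)))) x :=
      ((hasDerivAt_pow 2 x).const_mul (1 / 2 : ℝ)).neg
    refine h.exp.congr_deriv ?_
    rw [gaussWeight]
    push_cast
    ring
  have hW : ∀ x, gaussWeight (1 / 2) x = gaussWeight (1 / 2) x * (1 + 0 * x ^ 2) := by simp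
  have hlim : ∀ m : ℕ, m + 1 ≤ n →
      Tendsto (fun x => gaussWeight (1 / 2) x * x ^ m) atTop (𝓝 0) := fun m hm =>
    tendsto_zero_of_hasDerivAt_of_integrableOn_Ioi (a := 0)
      (fun x _ => hasDerivAt_mul_pow_of_pearson m (hW x) (hd x))
      (integrable_mul_pearson hint hm _ _).integrableOn (hint m (by omega)).integrableOn
  have hT := tailMoment_of_pearson hint (by intro m _; norm_num)
    (fun m hm u _ => integral_Ioi_of_pearson hint hW hd hlim m hm u)
  refine ⟨gaussWeight (1 / 2), fun k => -(((k + 1 : ℕ) : ℝ) / (-1 + (k + 1 : ℕ) * 0)),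
    fun k => -(-1 + (k : ℝ) * 0)⁻¹, ?_⟩
  exact {
    measurable_left := by unfold gaussWeight; fun_prop
    measurable_right := by unfold gaussWeight; fun_prop
    nonneg_left := fun x => (Real.exp_pos _).le
    nonneg_right := fun x => (Real.exp_pos _).le
    even_left := fun x => by simp [gaussWeight]
    even_right := fun x => by simp [gaussWeight]
    pos_left := fun x _ => Real.exp_pos _
    pos_right := fun x _ => Real.exp_pos _
    integrable_left := hint
    integrable_right := fun k _ => integrable_gaussWeight_mul_pow one_pos k
    nonneg_factor := fun x _ => (Real.exp_pos _).le
    mul_factor := fun x _ => by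
      simp only [gaussWeight, ← Real.exp_add]
      ring_nf
    tailMoment_one := hT.1
    tailMoment_add_two := hT.2 }

/-- The bound `|x| ^ k ≤ (1 + x²) ^ (k / 2)`, multiplied by the weight. -/
theorem cauchyWeight_mul_abs_pow_le (b x : ℝ) (k : ℕ) :
    cauchyWeight b x * |x| ^ k ≤ (1 + x ^ 2) ^ (-(2 * b - k) / 2) := by
  have h1 : 0 < 1 + x ^ 2 := by positivity
  have h2 : |x| ^ k ≤ (1 + x ^ 2) ^ ((k : ℝ) / 2) := by
    rw [← Real.rpow_natCast, show (k : ℝ) / 2 = 1 / 2 * k by ring, Real.rpow_mul h1.le,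
      ← Real.sqrt_eq_rpow]
    refine Real.rpow_le_rpow (abs_nonneg _) ?_ (Nat.cast_nonneg _)
    exact Real.le_sqrt_of_sq_le (by rw [sq_abs]; linarith)
  calc cauchyWeight b x * |x| ^ k ≤ (1 + x ^ 2) ^ (-b) * (1 + x ^ 2) ^ ((k : ℝ) / 2) :=
        mul_le_mul_of_nonneg_left h2 (Real.rpow_nonneg h1.le _)
    _ = _ := by rw [← Real.rpow_add h1]; ring_nf

theorem measurable_cauchyWeight (b : ℝ) : Measurable (cauchyWeight b) := by
  unfold cauchyWeight; fun_prop

theorem cauchyWeight_pos (b x : ℝ) : 0 < cauchyWeight b x :=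
  Real.rpow_pos_of_pos (by positivity) _

theorem integrable_cauchyWeight_mul_pow {b : ℝ} {k : ℕ} (hk : (k : ℝ) + 1 < 2 * b) :
    Integrable fun x => cauchyWeight b x * x ^ k := by
  have h := integrable_rpow_neg_one_add_norm_sq (E := ℝ) (μ := volume) (r := 2 * b - k)
    (by simp; linarith)
  refine h.mono' ((measurable_cauchyWeight b).mul (by fun_prop)).aestronglyMeasurable
    (Eventually.of_forall fun x => ?_)
  rw [norm_mul, norm_pow, Real.norm_of_nonneg (cauchyWeight_pos b x).le, Real.norm_eq_abs, sq_abs]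
  exact cauchyWeight_mul_abs_pow_le b x k

theorem tendsto_cauchyWeight_mul_pow {b : ℝ} {k : ℕ} (hk : (k : ℝ) < 2 * b) :
    Tendsto (fun x => cauchyWeight b x * x ^ k) atTop (𝓝 0) := by
  have h1 : Tendsto (fun x : ℝ => 1 + x ^ 2) atTop atTop :=
    tendsto_atTop_add_const_left _ _ (tendsto_pow_atTop two_ne_zero)
  have h2 := (tendsto_rpow_neg_atTop (y := (2 * b - k) / 2) (by linarith)).comp h1
  refine squeeze_zero_norm (fun x => ?_) h2
  rw [norm_mul, norm_pow, Real.norm_of_nonneg (cauchyWeight_pos b x).le, Real.norm_eq_abs]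
  refine (cauchyWeight_mul_abs_pow_le b x k).trans_eq ?_
  simp only [Function.comp]
  ring_nf

theorem hasDerivAt_cauchyWeight (b x : ℝ) :
    HasDerivAt (cauchyWeight (b - 1)) (2 * (1 - b) * x * cauchyWeight b x) x := by
  have h1 : 1 + x ^ 2 ≠ 0 := by positivity
  refine (((hasDerivAt_pow 2 x).const_add 1).rpow_const (p := -(b - 1))
    (Or.inl h1)).congr_deriv ?_
  rw [show -(b - 1) - 1 = -b by ring, cauchyWeight]
  push_cast
  ring

theorem exists_isPearsonPair_cauchy (n : ℕ) {a : ℝ} (ha : 0 < a) :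
    ∃ W α β, IsPearsonPair n (cauchyWeight (((n : ℝ) + a + 1) / 2)) (cauchyWeight ((n : ℝ) + a))
      W α β := by
  set b : ℝ := ((n : ℝ) + a + 1) / 2 with hb
  have hint : ∀ k ≤ n, Integrable fun x => cauchyWeight b x * x ^ k := fun k hk => by
    have : (k : ℝ) ≤ n := Nat.cast_le.2 hk
    exact integrable_cauchyWeight_mul_pow (by rw [hb]; linarith)
  have hd : ∀ x, HasDerivAt (cauchyWeight (b - 1)) (2 * (1 - b) * x * cauchyWeight b x) x :=
    hasDerivAt_cauchyWeight b
  have hW : ∀ x, cauchyWeight (b - 1) x = cauchyWeight b x * (1 + 1 * x ^ 2) := by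
    intro x
    have h1 : 0 < 1 + x ^ 2 := by positivity
    rw [one_mul, cauchyWeight, cauchyWeight, neg_sub, sub_eq_neg_add, Real.rpow_add h1,
      Real.rpow_one]
  have hlim : ∀ m : ℕ, m + 1 ≤ n →
      Tendsto (fun x => cauchyWeight (b - 1) x * x ^ m) atTop (𝓝 0) := fun m hm => by
    have : (m : ℝ) + 1 ≤ n := by exact_mod_cast hm
    exact tendsto_cauchyWeight_mul_pow (by rw [hb]; linarith)
  have hne : ∀ m : ℕ, m + 1 ≤ n → 2 * (1 - b) + m * 1 ≠ 0 := fun m hm => by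
    have : (m : ℝ) + 1 ≤ n := by exact_mod_cast hm
    rw [hb]
    linarith
  have hT := tailMoment_of_pearson hint hne
    (fun m hm u _ => integral_Ioi_of_pearson hint hW hd hlim m hm u)
  refine ⟨cauchyWeight (b - 1), fun k => -(((k + 1 : ℕ) : ℝ) / (2 * (1 - b) + (k + 1 : ℕ) * 1)),
    fun k => -(2 * (1 - b) + (k : ℝ) * 1)⁻¹, ?_⟩
  exact {
    measurable_left := measurable_cauchyWeight _
    measurable_right := measurable_cauchyWeight _
    nonneg_left := fun x => (cauchyWeight_pos _ x).le
    nonneg_right := fun x => (cauchyWeight_pos _ x).le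
    even_left := fun x => by simp [cauchyWeight]
    even_right := fun x => by simp [cauchyWeight]
    pos_left := fun x _ => cauchyWeight_pos _ x
    pos_right := fun x _ => cauchyWeight_pos _ x
    integrable_left := hint
    integrable_right := fun k hk => by
      have : (k : ℝ) + 2 ≤ 2 * n := by exact_mod_cast hk
      exact integrable_cauchyWeight_mul_pow (by linarith)
    nonneg_factor := fun x _ => (cauchyWeight_pos _ x).le
    mul_factor := fun x _ => by
      have h1 : 0 < 1 + x ^ 2 := by positivity
      rw [cauchyWeight, cauchyWeight, cauchyWeight, ← Real.rpow_add h1, hb]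
      ring_nf
    tailMoment_one := hT.1
    tailMoment_add_two := hT.2 }

theorem measurable_jacobiWeight (b : ℝ) : Measurable (jacobiWeight b) := by
  unfold jacobiWeight
  exact Measurable.indicator (by fun_prop) measurableSet_Ioo

theorem jacobiWeight_of_mem (b : ℝ) {x : ℝ} (hx : x ∈ Ioo (-1 : ℝ) 1) :
    jacobiWeight b x = (1 - x ^ 2) ^ b := indicator_of_mem hx _

theorem jacobiWeight_of_one_le (b : ℝ) {x : ℝ} (hx : 1 ≤ x) : jacobiWeight b x = 0 :=
  indicator_of_notMem (fun h => absurd h.2 hx.not_gt) _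

theorem one_sub_sq_pos {x : ℝ} (hx : x ∈ Ioo (-1 : ℝ) 1) : 0 < 1 - x ^ 2 := by
  nlinarith [hx.1, hx.2]

theorem jacobiWeight_nonneg (b x : ℝ) : 0 ≤ jacobiWeight b x :=
  indicator_nonneg (fun _ hx => Real.rpow_nonneg (one_sub_sq_pos hx).le _) x

theorem jacobiWeight_neg (b x : ℝ) : jacobiWeight b (-x) = jacobiWeight b x := by
  by_cases hx : x ∈ Ioo (-1 : ℝ) 1
  · have hx' : -x ∈ Ioo (-1 : ℝ) 1 := ⟨by linarith [hx.2], by linarith [hx.1]⟩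
    rw [jacobiWeight_of_mem b hx, jacobiWeight_of_mem b hx', neg_sq]
  · have hx' : -x ∉ Ioo (-1 : ℝ) 1 := fun h => hx ⟨by linarith [h.2], by linarith [h.1]⟩
    rw [jacobiWeight, indicator_of_notMem hx, indicator_of_notMem hx']

theorem jacobiWeight_pos (b : ℝ) {x : ℝ} (hx : x ∈ Ioo (0 : ℝ) 1) : 0 < jacobiWeight b x := by
  have hx' : x ∈ Ioo (-1 : ℝ) 1 := ⟨by linarith [hx.1], hx.2⟩
  rw [jacobiWeight_of_mem b hx']
  exact Real.rpow_pos_of_pos (one_sub_sq_pos hx') _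

theorem integrableOn_jacobi_half {b : ℝ} (hb : -1 < b) :
    IntegrableOn (fun x : ℝ => (1 - x ^ 2) ^ b) (Ioo 0 1) := by
  have h1 : IntervalIntegrable (fun x : ℝ => (1 - x) ^ b) volume 0 1 := by
    have := (intervalIntegral.intervalIntegrable_rpow' (a := 1) (b := 0) hb).comp_sub_left 1
    simpa using this
  have h2 : ContinuousOn (fun x : ℝ => (1 + x) ^ b) (uIcc 0 1) := by
    rw [uIcc_of_le zero_le_one]
    intro x hx
    have h0 : (1 : ℝ) + x ≠ 0 := by linarith [hx.1]
    exact ((continuous_const.add continuous_id).continuousAt.rpow_const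
      (Or.inl h0)).continuousWithinAt
  have h3 := (intervalIntegrable_iff_integrableOn_Ioo_of_le zero_le_one).1 (h1.mul_continuousOn h2)
  refine h3.congr_fun (fun x hx => ?_) measurableSet_Ioo
  change (1 - x) ^ b * (1 + x) ^ b = _
  rw [← Real.mul_rpow (by linarith [hx.2]) (by linarith [hx.1])]
  ring_nf

theorem integrable_jacobiWeight {b : ℝ} (hb : -1 < b) : Integrable (jacobiWeight b) := by
  have hpos : IntegrableOn (jacobiWeight b) (Ioi 0) := by
    have h1 : IntegrableOn (jacobiWeight b) (Ioo 0 1) :=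
      (integrableOn_jacobi_half hb).congr_fun (fun x hx =>
        (jacobiWeight_of_mem b ⟨by linarith [hx.1], hx.2⟩).symm) measurableSet_Ioo
    have h2 : IntegrableOn (jacobiWeight b) (Ici 1) :=
      integrableOn_zero.congr_fun (fun x hx => (jacobiWeight_of_one_le b hx).symm) measurableSet_Ici
    rw [← Ioo_union_Ici_eq_Ioi zero_lt_one]
    exact h1.union h2
  have hneg : IntegrableOn (jacobiWeight b) (Iio 0) := by
    rw [← (Measure.measurePreserving_neg (volume : Measure ℝ)).integrableOn_comp_preimage
      (Homeomorph.neg ℝ).measurableEmbedding]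
    simpa [Function.comp_def, jacobiWeight_neg] using hpos
  rw [← integrableOn_univ, ← Iic_union_Ioi (a := (0 : ℝ))]
  exact ((integrableOn_Iic_iff_integrableOn_Iio).2 hneg).union hpos

theorem integrable_jacobiWeight_mul_pow {b : ℝ} (hb : -1 < b) (k : ℕ) :
    Integrable fun x => jacobiWeight b x * x ^ k := by
  refine (integrable_jacobiWeight hb).mono'
    ((measurable_jacobiWeight b).mul (by fun_prop)).aestronglyMeasurable
    (Eventually.of_forall fun x => ?_)
  rw [norm_mul, Real.norm_of_nonneg (jacobiWeight_nonneg b x)]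
  by_cases hx : x ∈ Ioo (-1 : ℝ) 1
  · refine mul_le_of_le_one_right (jacobiWeight_nonneg b x) ?_
    rw [norm_pow]
    exact pow_le_one₀ (norm_nonneg _) (abs_le.2 ⟨hx.1.le, hx.2.le⟩)
  · rw [jacobiWeight, indicator_of_notMem hx, zero_mul]

/-- The Pearson equation of the Jacobi weight, integrated from `u` to `∞`. The weight vanishes
beyond `1`, where its derivative may fail to exist; the boundary term at `1` is zero because `0 <
a + 1`. -/
theorem integral_Ioi_jacobiWeight {a : ℝ} (ha : -1 < a) (m : ℕ) {u : ℝ} (hu : 0 ≤ u) :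
    ∫ x in Ioi u, jacobiWeight a x *
        (m * x ^ (m - 1) + (-2 * (a + 1) + m * (-1)) * x ^ (m + 1))
      = -(jacobiWeight (a + 1) u * u ^ m) := by
  rcases le_or_gt 1 u with h1 | h1
  · rw [jacobiWeight_of_one_le _ h1, zero_mul, neg_zero]
    refine setIntegral_eq_zero_of_forall_eq_zero fun x hx => ?_
    rw [jacobiWeight_of_one_le _ (h1.trans (le_of_lt hx)), zero_mul]
  have hint : Integrable fun x => jacobiWeight a x *
      (m * x ^ (m - 1) + (-2 * (a + 1) + m * (-1)) * x ^ (m + 1)) :=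
    integrable_mul_pearson (n := m + 1) (fun k _ => integrable_jacobiWeight_mul_pow ha k) le_rfl _ _
  have hzero : ∫ x in Ioi 1, jacobiWeight a x *
      (m * x ^ (m - 1) + (-2 * (a + 1) + m * (-1)) * x ^ (m + 1)) = 0 :=
    setIntegral_eq_zero_of_forall_eq_zero fun x hx => by
      rw [jacobiWeight_of_one_le _ (le_of_lt hx), zero_mul]
  rw [← Ioc_union_Ioi_eq_Ioi h1.le, setIntegral_union (Ioc_disjoint_Ioi le_rfl) measurableSet_Ioi
    hint.integrableOn hint.integrableOn, hzero, add_zero,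
    ← intervalIntegral.integral_of_le h1.le]
  have hcont : ContinuousOn (fun x : ℝ => (1 - x ^ 2) ^ (a + 1) * x ^ m) (Icc u 1) := by
    refine Continuous.continuousOn (Continuous.mul ?_ (by fun_prop))
    exact Continuous.rpow_const (by fun_prop) fun x => Or.inr (by linarith)
  have hderiv : ∀ x ∈ Ioo u 1, HasDerivAt (fun x : ℝ => (1 - x ^ 2) ^ (a + 1) * x ^ m)
      (jacobiWeight a x * (m * x ^ (m - 1) + (-2 * (a + 1) + m * (-1)) * x ^ (m + 1))) x := by
    intro x hx
    have hx' : x ∈ Ioo (-1 : ℝ) 1 := ⟨by linarith [hx.1], hx.2⟩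
    have h0 := one_sub_sq_pos hx'
    refine hasDerivAt_mul_pow_of_pearson (W := fun x => (1 - x ^ 2) ^ (a + 1)) m ?_ ?_
    · rw [jacobiWeight_of_mem a hx', Real.rpow_add h0, Real.rpow_one]
      ring
    · refine (((hasDerivAt_pow 2 x).const_sub 1).rpow_const (p := a + 1)
        (Or.inl h0.ne')).congr_deriv ?_
      rw [jacobiWeight_of_mem a hx', add_sub_cancel_right]
      push_cast
      ring
  rw [intervalIntegral.integral_eq_sub_of_hasDerivAt_of_le h1.le hcont hderiv
    hint.intervalIntegrable, jacobiWeight_of_mem _ ⟨by linarith, h1⟩]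
  have : (1 - (1 : ℝ) ^ 2) ^ (a + 1) = 0 := by
    rw [one_pow, sub_self, Real.zero_rpow (by linarith)]
  rw [this]
  ring

theorem exists_isPearsonPair_jacobi (n : ℕ) {a : ℝ} (ha : -1 < a) :
    ∃ W α β, IsPearsonPair n (jacobiWeight a) (jacobiWeight (2 * a + 1)) W α β := by
  have hint : ∀ k ≤ n, Integrable fun x => jacobiWeight a x * x ^ k := fun k _ =>
    integrable_jacobiWeight_mul_pow ha k
  have hne : ∀ m : ℕ, m + 1 ≤ n → -2 * (a + 1) + m * (-1) ≠ 0 := fun m _ => by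
    have : (0 : ℝ) ≤ m := Nat.cast_nonneg m
    linarith
  have hT := tailMoment_of_pearson hint hne (W := jacobiWeight (a + 1))
    fun m _ u hu => integral_Ioi_jacobiWeight ha m hu
  refine ⟨jacobiWeight (a + 1), fun k => -(((k + 1 : ℕ) : ℝ) / (-2 * (a + 1) + (k + 1 : ℕ) * (-1))),
    fun k => -(-2 * (a + 1) + (k : ℝ) * (-1))⁻¹, ?_⟩
  exact {
    measurable_left := measurable_jacobiWeight _
    measurable_right := measurable_jacobiWeight _
    nonneg_left := jacobiWeight_nonneg _
    nonneg_right := jacobiWeight_nonneg _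
    even_left := jacobiWeight_neg _
    even_right := jacobiWeight_neg _
    pos_left := fun x hx => jacobiWeight_pos _ hx
    pos_right := fun x hx => jacobiWeight_pos _ hx
    integrable_left := hint
    integrable_right := fun k _ => integrable_jacobiWeight_mul_pow (by linarith) k
    nonneg_factor := fun x _ => jacobiWeight_nonneg _ x
    mul_factor := fun x hx => by
      rcases le_or_gt 1 x with h1 | h1
      · rw [jacobiWeight_of_one_le _ h1, zero_mul, jacobiWeight_of_one_le _ h1]
      · have hx' : x ∈ Ioo (-1 : ℝ) 1 := ⟨by linarith, h1⟩
        rw [jacobiWeight_of_mem _ hx', jacobiWeight_of_mem _ hx', jacobiWeight_of_mem _ hx',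
          ← Real.rpow_add (one_sub_sq_pos hx')]
        ring_nf
    tailMoment_one := hT.1
    tailMoment_add_two := hT.2 }

theorem IsWeightPair.exists_isPearsonPair {n : ℕ} {w₁ w₂ : ℝ → ℝ} (hw : IsWeightPair n w₁ w₂) :
    ∃ W α β, IsPearsonPair n w₁ w₂ W α β := by
  cases hw with
  | gauss => exact exists_isPearsonPair_gauss n
  | jacobi a ha => exact exists_isPearsonPair_jacobi n ha
  | cauchy a ha => exact exists_isPearsonPair_cauchy n ha

end RandomEnsemble

open RandomEnsemble in
theorem corollary1 (n : ℕ) (w₁ w₂ : ℝ → ℝ) (hw : IsWeightPair n w₁ w₂) :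
    IsProbabilityMeasure (UE n w₂) ∧
    IsProbabilityMeasure (OE n w₁) ∧
    IsProbabilityMeasure (OE (n + 1) w₁) ∧
    IdentDistrib
      (fun x : Fin n → ℝ => singularValues x)
      (fun p : (Fin n → ℝ) × (Fin (n + 1) → ℝ) =>
        superpose (half_add_half n) (even (singularValues p.1)) (even (singularValues p.2)))
      (UE n w₂) ((OE n w₁).prod (OE (n + 1) w₁)) := by
  obtain ⟨W, α, β, hP⟩ := hw.exists_isPearsonPair
  exact ⟨hP.isProbabilityMeasure_unitary, hP.isProbabilityMeasure_orthogonal (Nat.le_succ n),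
    hP.isProbabilityMeasure_orthogonal le_rfl, hP.identDistrib⟩
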